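/- Let $G$ be a finite tree with at least one edge, with vertex set $[n]$, and let $[n]=A\cup B$ be its bipartition, named so that $a:=|A|\le |B|=:b$. Let $\mathbb K$ be a field and $S=\mathbb K[x_1,\dots,x_n]$, $\mathfrak m=(x_1,\dots,x_n)$. A $k$-cover of $G$ is a vector $\mathbf c\in\mathbb N^n$ with $c_i+c_j\ge k$ for every edge $\{i,j\}$ of $G$. Let $A(G)\subseteq S[t]$ be the graded algebra spanned over $\mathbb K$ by the monomials $x_1^{c_1}\cdots x_n^{c_n}t^k$ with $k\ge 0$ and $\mathbf c$ a $k$-cover of $G$, and let $\bar A(G)=A(G)/\mathfrak mA(G)$, graded by the degree in $t$. Its multiplicity $e(\bar A(G))$ is $\lim_{k\to\infty} d!\,\dim_{\mathbb K}\bar A(G)_k/k^{d}$, where $d=\dim\bar A(G)-1$. A standard drawing $\Gamma$ of $G$ is a labelling of the elements of $A$ by $1,\dots,a$ and of the elements of $B$ by $1',\dots,b'$ (if $a=b$, either side may be taken as $A$). Let $r(\Gamma)$ be the largest $s\in\{0,\dots,a\}$ such that $\{i,i'\}$ is an edge for every $1\le i\le s$ and $\{i,j'\}$ is not an edge whenever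 $j<i\le s$. Let $\operatorname{gdim}(G)=1+\max_\Gamma r(\Gamma)$. Then $$\dim \bar A(G)=\operatorname{gdim}(G).$$ Moreover, with $r=\operatorname{gdim}(G)-1$ (so that $1\le r\le a$), the multiplicity of $\bar A(G)$ exists, is a nonnegative integer, and satisfies $$e(\bar A(G))\le r^{\,a-r}\cdot a(a-1)\cdots(a-r+1),$$ and, if $r<a$, also $$e(\bar A(G))\le (a-r)^{r}\cdot a(a-1)\cdots(a-r+1).$$ -/

import Mathlib

open Filter Topology

noncomputable section

namespace CoverAlgebra

universe u v

/-- The exponent `c : Option V →₀ ℕ` of the monomial `t^k ∏ x_v^(c_v)`, where `k = c none` is the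
exponent of `t`, is a `k`-cover of `G`: `c_i + c_j ≥ k` for every edge `{i, j}`. The zero vector,
which can only satisfy this for `k = 0` when `G` has an edge, is admitted, so that the degree-zero
part of the vertex cover algebra is the whole polynomial ring `S` and contains `1`. -/
def IsCover {V : Type v} (G : SimpleGraph V) (c : Option V →₀ ℕ) : Prop :=
  ∀ i j : V, G.Adj i j → c none ≤ c (some i) + c (some j)

/-- The vertex cover algebra `A(G) ⊆ S[t] = K[x_v, t : v ∈ V]`, where `x_v = X (some v)` and
`t = X none`: the polynomials all of whose monomials are of the form `x^c t^k` with `c` a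
`k`-cover, i.e. the `K`-span of these monomials. -/
def vertexCoverAlgebra (K : Type u) [Field K] {V : Type v} (G : SimpleGraph V) :
    Subalgebra K (MvPolynomial (Option V) K) where
  carrier := {f | ∀ c ∈ f.support, IsCover G c}
  mul_mem' := by
    classical
    intro f g hf hg c hc
    obtain ⟨c₁, h₁, c₂, h₂, rfl⟩ := Finset.mem_add.1 (MvPolynomial.support_mul _ _ hc)
    intro i j hij
    have e₁ := hf c₁ h₁ i j hij
    have e₂ := hg c₂ h₂ i j hij
    simp only [Finsupp.add_apply]
    omega
  add_mem' := by
    classical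
    intro f g hf hg c hc
    rcases Finset.mem_union.1 (MvPolynomial.support_add hc) with h | h
    · exact hf c h
    · exact hg c h
  algebraMap_mem' := by
    classical
    intro s c hc i j _
    rw [MvPolynomial.mem_support_iff, MvPolynomial.algebraMap_eq, MvPolynomial.coeff_C] at hc
    split_ifs at hc with h
    · subst h
      simp
    · exact absurd rfl hc

theorem X_mem_vertexCoverAlgebra (K : Type u) [Field K] {V : Type v} (G : SimpleGraph V) (w : V) :
    (MvPolynomial.X (some w) : MvPolynomial (Option V) K) ∈ vertexCoverAlgebra K G := by
  classical
  intro c hc i j _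
  rw [MvPolynomial.support_X, Finset.mem_singleton] at hc
  subst hc
  simp

/-- The ideal `𝔪 A(G)` of `A(G)`, generated by the variables `x_v`, `v ∈ V`; here
`𝔪 = (x_v : v ∈ V)` is the irrelevant ideal of `S = K[x_v : v ∈ V]`. -/
def irrelevantExtension (K : Type u) [Field K] {V : Type v} (G : SimpleGraph V) :
    Ideal (vertexCoverAlgebra K G) :=
  Ideal.span (Set.range fun w : V =>
    (⟨MvPolynomial.X (some w), X_mem_vertexCoverAlgebra K G w⟩ : vertexCoverAlgebra K G))

/-- The algebra of basic covers `Ā(G) = A(G) / 𝔪 A(G)`. -/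
def basicCoverAlgebra (K : Type u) [Field K] {V : Type v} (G : SimpleGraph V) : Type (max u v) :=
  vertexCoverAlgebra K G ⧸ irrelevantExtension K G

instance (K : Type u) [Field K] {V : Type v} (G : SimpleGraph V) :
    CommRing (basicCoverAlgebra K G) :=
  Ideal.Quotient.commRing (irrelevantExtension K G)

instance (K : Type u) [Field K] {V : Type v} (G : SimpleGraph V) :
    Algebra K (basicCoverAlgebra K G) :=
  Ideal.Quotient.algebra K (I := irrelevantExtension K G)

/-- The projection `A(G) → Ā(G)`. -/
def toBasic (K : Type u) [Field K] {V : Type v} (G : SimpleGraph V) :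
    vertexCoverAlgebra K G →ₐ[K] basicCoverAlgebra K G :=
  Ideal.Quotient.mkₐ K (irrelevantExtension K G)

/-- `A(G)_k`, the elements of `A(G)` all of whose monomials have degree `k` in `t`. -/
def vertexCoverComponent (K : Type u) [Field K] {V : Type v} (G : SimpleGraph V) (k : ℕ) :
    Submodule K (vertexCoverAlgebra K G) where
  carrier := {f | ∀ c ∈ (f : MvPolynomial (Option V) K).support, c none = k}
  add_mem' := by
    classical
    intro f g hf hg c hc
    rcases Finset.mem_union.1 (MvPolynomial.support_add hc) with h | h
    · exact hf c h
    · exact hg c h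
  zero_mem' := by
    intro c hc
    simp at hc
  smul_mem' := by
    intro a f hf c hc
    exact hf c (MvPolynomial.support_smul hc)

/-- `Ā(G)_k`, the degree `k` component of `Ā(G)`: the image of `A(G)_k`. -/
def basicCoverComponent (K : Type u) [Field K] {V : Type v} (G : SimpleGraph V) (k : ℕ) :
    Submodule K (basicCoverAlgebra K G) :=
  (vertexCoverComponent K G k).map (toBasic K G).toLinearMap

/-- The Hilbert function of a family of graded components. -/
def hilbertFunction (K : Type u) [Field K] {R : Type v} [CommRing R] [Algebra K R]
    (comp : ℕ → Submodule K R) (k : ℕ) : ℕ :=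
  Module.finrank K (comp k)

/-- The graded `K`-algebra `R` (of positive Krull dimension `d + 1`) has multiplicity `e`: its
components are finite dimensional and the Hilbert function grows as `(e / d!) k ^ d`. -/
def HasMultiplicity (K : Type u) [Field K] {R : Type v} [CommRing R] [Algebra K R]
    (comp : ℕ → Submodule K R) (e : ℝ) : Prop :=
  (∀ k, FiniteDimensional K (comp k)) ∧
    ∃ d : ℕ, ringKrullDim R = ((d + 1 : ℕ) : WithBot ℕ∞) ∧
      Tendsto (fun k : ℕ => (d.factorial : ℝ) * (hilbertFunction K comp k : ℝ) / (k : ℝ) ^ d)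
        atTop (𝓝 e)

/-- A standard drawing of a connected bipartite graph: the vertices of the two sides of the
bipartition are labelled `0, …, a - 1` and `0', …, (b - 1)'` (counting from `0`), where `a ≤ b`. -/
structure StandardDrawing {V : Type v} (G : SimpleGraph V) where
  /-- The number of vertices on the upper line. -/
  a : ℕ
  /-- The number of vertices on the lower line. -/
  b : ℕ
  a_le_b : a ≤ b
  /-- The labelling of the vertices. -/
  vertex : Fin a ⊕ Fin b ≃ V
  not_adj_upper : ∀ i j : Fin a, ¬ G.Adj (vertex (Sum.inl i)) (vertex (Sum.inl j))
  not_adj_lower : ∀ i j : Fin b, ¬ G.Adj (vertex (Sum.inr i)) (vertex (Sum.inr j))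

/-- The upper vertex `i` and the lower vertex `j'` are adjacent in the drawing. -/
def StandardDrawing.Edge {V : Type v} {G : SimpleGraph V} (Γ : StandardDrawing G)
    (i : Fin Γ.a) (j : Fin Γ.b) : Prop :=
  G.Adj (Γ.vertex (Sum.inl i)) (Γ.vertex (Sum.inr j))

/-- The first `s` upper vertices (`s ≤ a`) are joined to the lower vertices of the same label by
vertical edges and have no slash edges. -/
def StandardDrawing.Good {V : Type v} {G : SimpleGraph V} (Γ : StandardDrawing G) (s : ℕ) : Prop :=
  s ≤ Γ.a ∧
    (∀ (i : Fin Γ.a) (j : Fin Γ.b), (i : ℕ) < s → (j : ℕ) = i → Γ.Edge i j) ∧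
    (∀ (i : Fin Γ.a) (j : Fin Γ.b), (i : ℕ) < s → (j : ℕ) < i → ¬ Γ.Edge i j)

/-- `r(Γ)`, the largest `s` such that the first `s` positions are good. -/
def StandardDrawing.r {V : Type v} {G : SimpleGraph V} (Γ : StandardDrawing G) : ℕ :=
  sSup {s | Γ.Good s}

/-- The graphical dimension of a connected bipartite graph with at least two vertices. -/
def gdim {V : Type v} (G : SimpleGraph V) : ℕ :=
  1 + sSup (Set.range fun Γ : StandardDrawing G => Γ.r)

end CoverAlgebra

end

noncomputable section

namespace CoverAlgebra

universe u v

/-! ### Leaves, ordered matchings and layerings of a tree. -/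

section Trees

variable {V : Type v} {G : SimpleGraph V}

/-! The quotient $\bar A(G)$ has as a basis the monomials of basic covers, those from which no unit
vector can be split off; they are the covers with a tight edge at every vertex (`isBasic_iff`).
Replacing $c_j$ by $k-c_j$ off $A$ turns basic $k$-covers into layerings $V\to\{0,\dots,k\}$:
functions weakly decreasing from $A$ to its neighbours and constant on some edge at each vertex
(`bijective_toCover`). Counting layerings by their set of values gives the Hilbert function
$\sum_s\binom{k+1}{s}\sigma_s$, where $\sigma_s$ counts surjective layerings onto $s$ values
(`layerings_eq_sum`). A vertex cover $W$ meets every constant edge, so all values already occur on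
$W$ and $\sigma_s=0$ for $s>|W|$.

Peeling off leaves yields a vertex cover $W$ together with an ordered matching of the same size
(`exists_isOrderedMatchingCover`), a König theorem with an extra triangularity condition. The
matching is a good segment of a drawing and $W$ bounds every such segment, so `gdim G` is $|W|+1$.
The matching also produces a layering with at least $|W|$ values
(`IsOrderedMatchingCover.exists_isLayering`).

For the dimension, polynomial growth and Noether normalization give $\dim\le|W|+1$
(`ringKrullDim_le`). Conversely, the covers tight on the constant edges of that layering span a
domain that is a quotient of $\bar A(G)$, and specializing variables to $1$ one level at a time
gives a chain of $|W|+2$ primes (`le_ringKrullDim`). The multiplicity is then $\sigma_r$ with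
$r=|W|$.

For the bounds, a layering is determined by its restriction to $A$, so $\sigma_r$ is at most the
number of surjections from $A$ onto $r$ values. Alternatively, a surjective layering with $r$ values
is a bijection on $W$, and the rest is recorded by a surjective choice of neighbours $A\setminus
W\to W\setminus A$; there are few such choices in a tree. -/

theorem exists_parent (hG : G.IsTree) : ∃ (d : V → ℕ) (p : V → V), ∀ v w, G.Adj v w →
    (p v = w ∧ d v = d w + 1) ∨ (p w = v ∧ d w = d v + 1) := by
  classical
  obtain ⟨ρ⟩ := hG.connected.nonempty
  -- A vertex has only one neighbour nearer to the root `ρ`: geodesics through two such neighbours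
  -- would be two paths from `ρ` to `v`.
  have uniq : ∀ v w w', G.Adj v w → G.Adj v w' → G.dist ρ v = G.dist ρ w + 1 →
      G.dist ρ v = G.dist ρ w' + 1 → w = w' := by
    intro v w w' h h' e e'
    obtain ⟨q, hq, hq'⟩ := (hG.connected ρ w).exists_path_of_dist
    obtain ⟨q', hr, hr'⟩ := (hG.connected ρ w').exists_path_of_dist
    have key : ∀ (x : V) (q : G.Walk ρ x) (hx : G.Adj x v), q.IsPath → q.length = G.dist ρ x →
        G.dist ρ v = G.dist ρ x + 1 → (q.concat hx).IsPath := by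
      intro x q hx hq hl e
      refine SimpleGraph.Walk.isPath_of_length_eq_dist _ ?_
      rw [SimpleGraph.Walk.length_concat, hl, e]
    have h1 := key w q h.symm hq hq' e
    have h2 := key w' q' h'.symm hr hr' e'
    have := congrArg (fun p : G.Path ρ v => (p : G.Walk ρ v).penultimate)
      ((hG.isAcyclic.subsingleton_path ρ v).elim ⟨_, h1⟩ ⟨_, h2⟩)
    simpa using this
  refine ⟨G.dist ρ, fun v => if h : ∃ w, G.Adj v w ∧ G.dist ρ v = G.dist ρ w + 1
    then h.choose else v, ?_⟩
  have hp : ∀ v w, G.Adj v w → G.dist ρ v = G.dist ρ w + 1 →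
      (if h : ∃ w, G.Adj v w ∧ G.dist ρ v = G.dist ρ w + 1 then h.choose else v) = w := by
    intro v w h e
    have hex : ∃ w, G.Adj v w ∧ G.dist ρ v = G.dist ρ w + 1 := ⟨w, h, e⟩
    rw [dif_pos hex]
    exact uniq v _ _ hex.choose_spec.1 h hex.choose_spec.2 e
  intro v w h
  rcases hG.dist_eq_dist_add_one_of_adj ρ h with e | e
  · exact Or.inl ⟨hp v w h e, e⟩
  · exact Or.inr ⟨hp w v h.symm e, e⟩

/-- Every nonempty finite set of vertices of a tree has a member with at most one neighbour in
the set. -/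
theorem exists_leaf (hG : G.IsTree) {S : Finset V} (hS : S.Nonempty) :
    ∃ v ∈ S, ∀ w ∈ S, ∀ w' ∈ S, G.Adj v w → G.Adj v w' → w = w' := by
  obtain ⟨d, p, h⟩ := exists_parent hG
  -- A vertex of `S` farthest from the root has no child in `S`, so its only possible neighbour
  -- there is its parent.
  obtain ⟨v, hv, hmax⟩ := S.exists_max_image d hS
  refine ⟨v, hv, fun w hw w' hw' a a' => ?_⟩
  have := hmax w hw
  have := hmax w' hw'
  have h1 := h v w a
  have h2 := h v w' a'
  have e1 : p v = w := by rcases h1 with h1 | h1; exacts [h1.1, by omega]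
  have e2 : p v = w' := by rcases h2 with h1 | h1; exacts [h1.1, by omega]
  exact e1.symm.trans e2

/-- The subgraph of a tree induced on `S` has a vertex cover `W` and an ordered matching of the
same size. -/
theorem exists_cover_and_orderedMatching_on [DecidableEq V] (hG : G.IsTree) {A : Finset V}
    (hA : ∀ v w, G.Adj v w → (v ∈ A ↔ w ∉ A)) (S : Finset V) :
    ∃ W : Finset V, W ⊆ S ∧ ∃ L : List (V × V), L.length = W.card ∧
      (∀ e ∈ L, e.1 ∈ A ∧ e.1 ∈ S ∧ e.2 ∈ S ∧ G.Adj e.1 e.2) ∧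
      L.Pairwise (fun e f => ¬ G.Adj f.1 e.2) ∧
      ∀ u ∈ S, ∀ v ∈ S, G.Adj u v → u ∈ W ∨ v ∈ W := by
  induction S using Finset.strongInduction with
  | H S ih =>
    rcases S.eq_empty_or_nonempty with rfl | hS
    · exact ⟨∅, by simp, [], by simp⟩
    obtain ⟨v, hv, hleaf⟩ := exists_leaf hG hS
    by_cases hw : ∃ w ∈ S, G.Adj v w
    · obtain ⟨w, hw, hvw⟩ := hw
      obtain ⟨W, hWS, L, hL, hL1, hL2, hW⟩ := ih ((S.erase v).erase w)
        ((Finset.erase_subset _ _).trans_ssubset (Finset.erase_ssubset hv))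
      have hsub : ∀ x, x ∈ (S.erase v).erase w ↔ x ≠ w ∧ x ≠ v ∧ x ∈ S := by simp
      have hwW : w ∉ W := fun h => by simpa using hWS h
      refine ⟨insert w W, ?_, ?_⟩
      · exact Finset.insert_subset hw fun x hx => ((hsub x).1 (hWS hx)).2.2
      have hcov : ∀ x ∈ S, ∀ y ∈ S, G.Adj x y → x ∈ insert w W ∨ y ∈ insert w W := by
        intro x hx y hy hxy
        simp only [Finset.mem_insert]
        by_cases h1 : x = w; · simp [h1]
        by_cases h2 : y = w; · simp [h2]
        by_cases h3 : x = v
        · subst h3; exact absurd (hleaf y hy w hw hxy hvw) h2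
        by_cases h4 : y = v
        · subst h4; exact absurd (hleaf x hx w hw hxy.symm hvw) h1
        rcases hW x ((hsub x).2 ⟨h1, h3, hx⟩) y ((hsub y).2 ⟨h2, h4, hy⟩) hxy with h | h <;>
          simp [h]
      -- The leaf `v` has no neighbour but `w` in `S`. If `v` lies in `A`, its edge goes last, where
      -- `v` must avoid all earlier second entries; otherwise it goes first, where all later first
      -- entries must avoid `v`.
      by_cases hvA : v ∈ A
      · refine ⟨L ++ [(v, w)], by simp [hL, hwW], ?_, ?_, hcov⟩
        · intro e he
          rcases List.mem_append.1 he with he | he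
          · obtain ⟨h1, h2, h3, h4⟩ := hL1 e he
            exact ⟨h1, ((hsub _).1 h2).2.2, ((hsub _).1 h3).2.2, h4⟩
          · obtain rfl : e = (v, w) := by simpa using he
            exact ⟨hvA, hv, hw, hvw⟩
        · rw [List.pairwise_append]
          refine ⟨hL2, by simp, fun e he f hf hadj => ?_⟩
          obtain rfl : f = (v, w) := by simpa using hf
          obtain ⟨h1, h2, h3⟩ := (hsub _).1 (hL1 e he).2.2.1
          exact h1 (hleaf _ h3 w hw hadj hvw)
      · refine ⟨(w, v) :: L, by simp [hL, hwW], ?_, ?_, hcov⟩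
        · intro e he
          rcases List.mem_cons.1 he with rfl | he
          · exact ⟨by_contra fun h => hvA ((hA v w hvw).2 h), hw, hv, hvw.symm⟩
          · obtain ⟨h1, h2, h3, h4⟩ := hL1 e he
            exact ⟨h1, ((hsub _).1 h2).2.2, ((hsub _).1 h3).2.2, h4⟩
        · rw [List.pairwise_cons]
          refine ⟨fun f hf hadj => ?_, hL2⟩
          obtain ⟨h1, h2, h3⟩ := (hsub _).1 (hL1 f hf).2.1
          exact h1 (hleaf _ h3 w hw hadj.symm hvw)
    · obtain ⟨W, hWS, L, hL, hL1, hL2, hW⟩ := ih (S.erase v) (Finset.erase_ssubset hv)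
      refine ⟨W, hWS.trans (Finset.erase_subset _ _), L, hL, fun e he => ?_, hL2, ?_⟩
      · obtain ⟨h1, h2, h3, h4⟩ := hL1 e he
        exact ⟨h1, Finset.mem_of_mem_erase h2, Finset.mem_of_mem_erase h3, h4⟩
      · intro x hx y hy hxy
        have h1 : x ≠ v := by rintro rfl; exact hw ⟨y, hy, hxy⟩
        have h2 : y ≠ v := by rintro rfl; exact hw ⟨x, hx, hxy.symm⟩
        exact hW x (Finset.mem_erase.2 ⟨h1, hx⟩) y (Finset.mem_erase.2 ⟨h2, hy⟩) hxy

/-- A vertex cover `W` together with a matching of the same size, whose edges `{x l, y l}` can be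
ordered so that `x l` is not adjacent to `y m` for `m < l`. -/
structure IsOrderedMatchingCover (G : SimpleGraph V) (A W : Finset V) (x y : Fin W.card → V) :
    Prop where
  mem : ∀ l, x l ∈ A
  adj : ∀ l, G.Adj (x l) (y l)
  not_adj : ∀ l m, m < l → ¬ G.Adj (x l) (y m)
  cover : ∀ u v, G.Adj u v → u ∈ W ∨ v ∈ W

theorem exists_isOrderedMatchingCover [Fintype V] [DecidableEq V] (hG : G.IsTree) {A : Finset V}
    (hA : ∀ v w, G.Adj v w → (v ∈ A ↔ w ∉ A)) :
    ∃ (W : Finset V) (x y : Fin W.card → V), IsOrderedMatchingCover G A W x y := by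
  obtain ⟨W, -, L, hL, h1, h2, h3⟩ := exists_cover_and_orderedMatching_on hG hA Finset.univ
  refine ⟨W, fun l => (L.get (l.cast hL.symm)).1, fun l => (L.get (l.cast hL.symm)).2, ?_, ?_, ?_,
    ?_⟩
  · exact fun l => (h1 _ (L.get_mem _)).1
  · exact fun l => (h1 _ (L.get_mem _)).2.2.2
  · intro l m hlm
    exact List.pairwise_iff_get.1 h2 (m.cast hL.symm) (l.cast hL.symm) hlm
  · exact fun u v h => h3 u (Finset.mem_univ _) v (Finset.mem_univ _) h

namespace IsOrderedMatchingCover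

variable {A W : Finset V} {x y : Fin W.card → V}

theorem injective_fst (h : IsOrderedMatchingCover G A W x y) : Function.Injective x := by
  intro l m e
  rcases lt_trichotomy l m with hlm | hlm | hlm
  · exact absurd (e ▸ h.adj l) (h.not_adj m l hlm)
  · exact hlm
  · exact absurd (e ▸ h.adj m) (h.not_adj l m hlm)

theorem injective_snd (h : IsOrderedMatchingCover G A W x y) : Function.Injective y := by
  intro l m e
  rcases lt_trichotomy l m with hlm | hlm | hlm
  · exact absurd (e ▸ h.adj m) (h.not_adj m l hlm)
  · exact hlm
  · exact absurd (e ▸ h.adj l) (h.not_adj l m hlm)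

end IsOrderedMatchingCover

/-- A layering of a bipartite graph, one of whose sides is `A`: a function which does not increase
along the edges leaving `A` and takes at every vertex the same value as at some neighbour. -/
structure IsLayering (G : SimpleGraph V) (A : Finset V) {α : Type*} [LinearOrder α] (ψ : V → α) :
    Prop where
  le : ∀ i ∈ A, ∀ j, G.Adj i j → ψ j ≤ ψ i
  tight : ∀ v, ∃ w, G.Adj v w ∧ ψ w = ψ v

namespace IsLayering

variable {A W : Finset V} {α β : Type*} [LinearOrder α] [LinearOrder β] {ψ ψ' : V → α}

theorem comp_monotone (h : IsLayering G A ψ) {f : α → β} (hf : Monotone f) :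
    IsLayering G A (f ∘ ψ) where
  le i hi j hij := hf (h.le i hi j hij)
  tight v := by
    obtain ⟨w, hw, e⟩ := h.tight v
    exact ⟨w, hw, congrArg f e⟩

theorem of_comp_strictMono {f : α → β} (hf : StrictMono f) (h : IsLayering G A (f ∘ ψ)) :
    IsLayering G A ψ where
  le i hi j hij := hf.le_iff_le.1 (h.le i hi j hij)
  tight v := by
    obtain ⟨w, hw, e⟩ := h.tight v
    exact ⟨w, hw, hf.injective e⟩

/-- The constant edge at `v` meets `W`. Hence a layering has at most `W.card` values. -/
theorem exists_mem_cover (h : IsLayering G A ψ) (hW : ∀ u v, G.Adj u v → u ∈ W ∨ v ∈ W) (v : V) :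
    ∃ w ∈ W, ψ w = ψ v := by
  obtain ⟨w, hw, e⟩ := h.tight v
  rcases hW v w hw with h' | h'
  exacts [⟨v, h', rfl⟩, ⟨w, h', e⟩]

/-- A layering is determined by its restriction to `A`. -/
theorem eq_of_eqOn (hA : ∀ v w, G.Adj v w → (v ∈ A ↔ w ∉ A)) (h : IsLayering G A ψ)
    (h' : IsLayering G A ψ') (he : ∀ i ∈ A, ψ i = ψ' i) : ψ = ψ' := by
  -- Off `A` the value is forced to be the minimum of the values at the neighbours.
  have key : ∀ {ψ ψ' : V → α}, IsLayering G A ψ → IsLayering G A ψ' → (∀ i ∈ A, ψ i = ψ' i) →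
      ∀ j, j ∉ A → ψ j ≤ ψ' j := by
    intro ψ ψ' h h' he j hj
    obtain ⟨i, hij, e⟩ := h'.tight j
    have hi : i ∈ A := (hA i j hij.symm).2 hj
    rw [← e, ← he i hi]
    exact h.le i hi j hij.symm
  funext v
  by_cases hv : v ∈ A
  · exact he v hv
  · exact le_antisymm (key h h' he v hv) (key h' h (fun i hi => (he i hi).symm) v hv)

end IsLayering

/-- Weights on `A` are turned into a layering by two closures: off `A` take the minimum over
neighbours, then on `A` the maximum of these minima. Weights decreasing along the matching make the
minimum at `y l` equal to the weight of `x l`, because `y l` is not adjacent to any later `x m`. -/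
theorem IsOrderedMatchingCover.exists_isLayering [Fintype V] {A W : Finset V}
    {x y : Fin W.card → V}
    (h : IsOrderedMatchingCover G A W x y) (hA : ∀ v w, G.Adj v w → (v ∈ A ↔ w ∉ A))
    (hdeg : ∀ v, ∃ w, G.Adj v w) :
    ∃ ψ : V → ℕ, IsLayering G A ψ ∧ ∀ t < W.card, ∃ w, ψ w = t := by
  classical
  set c : V → ℕ := fun v => if hv : ∃ l, x l = v then W.card - 1 - (hv.choose : ℕ) else W.card
  have hcx : ∀ l : Fin W.card, c (x l) = W.card - 1 - l := by
    intro l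
    have hex : ∃ m, x m = x l := ⟨l, rfl⟩
    simp only [c, dif_pos hex, h.injective_fst hex.choose_spec]
  have hcx' : ∀ v, (∀ l, x l ≠ v) → c v = W.card := by
    intro v hv
    simp only [c, dif_neg (not_exists.2 hv)]
  set f : V → ℕ := fun j => sInf (c '' {i | G.Adj i j})
  have hfne : ∀ j, (c '' {i | G.Adj i j}).Nonempty := fun j =>
    (Set.Nonempty.image _ ((hdeg j).imp fun w hw => hw.symm))
  have hfle : ∀ i j, G.Adj i j → f j ≤ c i := fun i j hij => Nat.sInf_le ⟨i, hij, rfl⟩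
  have hfmem : ∀ j, ∃ i, G.Adj i j ∧ c i = f j := fun j => Nat.sInf_mem (hfne j)
  set g : V → ℕ := fun i => (Finset.univ.filter fun j => G.Adj i j).sup f
  have hgle : ∀ i j, G.Adj i j → f j ≤ g i := fun i j hij =>
    Finset.le_sup (f := f) (by simpa using hij)
  have hgmem : ∀ i, ∃ j, G.Adj i j ∧ f j = g i := by
    intro i
    obtain ⟨j, hj, e⟩ := Finset.exists_mem_eq_sup (Finset.univ.filter fun j => G.Adj i j)
      ((hdeg i).imp fun w hw => by simpa using hw) f
    exact ⟨j, by simpa using hj, e.symm⟩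
  have hgc : ∀ i, g i ≤ c i := fun i => Finset.sup_le fun j hj => hfle i j (by simpa using hj)
  have hmemB : ∀ l, y l ∉ A := fun l => (hA _ _ (h.adj l)).1 (h.mem l)
  refine ⟨fun v => if v ∈ A then g v else f v, ⟨?_, ?_⟩, ?_⟩
  · intro i hi j hij
    simp only [if_pos hi, if_neg ((hA i j hij).1 hi)]
    exact hgle i j hij
  · intro v
    by_cases hv : v ∈ A
    · obtain ⟨j, hj, e⟩ := hgmem v
      exact ⟨j, hj, by simp only [if_pos hv, if_neg ((hA v j hj).1 hv), e]⟩
    · obtain ⟨i, hi, e⟩ := hfmem v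
      refine ⟨i, hi.symm, ?_⟩
      simp only [if_neg hv, if_pos ((hA i v hi).2 hv)]
      -- If `i` attains the minimum at `v`, then `f v ≤ g i ≤ c i = f v`, so the edge remains
      -- constant after the second closure.
      exact le_antisymm ((hgc i).trans e.le) (hgle i v hi)
  · intro t ht
    set l : Fin W.card := ⟨W.card - 1 - t, by omega⟩
    refine ⟨y l, ?_⟩
    simp only [if_neg (hmemB l)]
    have hl : c (x l) = t := by rw [hcx]; simp only [l]; omega
    refine le_antisymm ((hfle _ _ (h.adj l)).trans hl.le) ?_
    obtain ⟨i, hi, e⟩ := hfmem (y l)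
    rw [← e]
    by_cases hix : ∃ m, x m = i
    · obtain ⟨m, rfl⟩ := hix
      have : ¬ l < m := fun hlm => h.not_adj m l hlm hi
      rw [hcx]
      have h1 : (m : ℕ) ≤ l := by simpa using this
      have h2 : (l : ℕ) = W.card - 1 - t := rfl
      omega
    · rw [hcx' i (not_exists.1 hix)]
      exact ht.le

end Trees

/-! ### Counting neighbour choices and surjective layerings; the graphical dimension. -/

section Trees

variable {V : Type v} {G : SimpleGraph V}

/-- In a tree, there are at most `2 ^ |Q|` ways of choosing for every vertex in `U` a neighbour
in `Q`. -/
theorem card_neighborChoice_le [DecidableEq V] (hG : G.IsTree) (U Q : Finset V) :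
    Nat.card {φ : U → Q // ∀ u : U, G.Adj (u : V) (φ u)} ≤ 2 ^ Q.card := by
  classical
  obtain ⟨d, p, hp⟩ := exists_parent hG
  have : Nat.card (Finset Q) = 2 ^ Q.card := by simp
  rw [← this]
  -- Encode a choice by the set of vertices of `Q` chosen by their own parent. A vertex of `U` whose
  -- choice is not recorded in this way has chosen its parent.
  refine Nat.card_le_card_of_injective
    (fun φ => Finset.univ.filter fun j : Q => ∃ u : U, p j = (u : V) ∧ φ.1 u = j) ?_
  have key : ∀ φ φ' : {φ : U → Q // ∀ u : U, G.Adj (u : V) (φ u)},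
      (Finset.univ.filter fun j : Q => ∃ u : U, p j = (u : V) ∧ φ.1 u = j) =
      (Finset.univ.filter fun j : Q => ∃ u : U, p j = (u : V) ∧ φ'.1 u = j) →
      ∀ u : U, p (φ.1 u) = u → φ'.1 u = φ.1 u := by
    intro φ φ' e u hu
    have : φ.1 u ∈ Finset.univ.filter fun j : Q => ∃ u : U, p j = (u : V) ∧ φ'.1 u = j := by
      rw [← e]
      simp only [Finset.mem_filter, Finset.mem_univ, true_and]
      exact ⟨u, hu, rfl⟩
    simp only [Finset.mem_filter, Finset.mem_univ, true_and] at this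
    obtain ⟨u', hu', e'⟩ := this
    obtain rfl : u' = u := Subtype.ext (hu'.symm.trans hu)
    exact e'
  intro φ φ' e
  refine Subtype.ext (funext fun u => ?_)
  rcases hp _ _ (φ.2 u) with h | h
  · rcases hp _ _ (φ'.2 u) with h' | h'
    · exact Subtype.ext (h.1.symm.trans h'.1)
    · exact key φ' φ e.symm u h'.1
  · exact (key φ φ' e u h.1).symm

/-- If a set `U` of vertices of a tree has one element more than `Q`, then there are at most `|U|`
surjections `U → Q` which send every vertex to a neighbour. -/
theorem card_surjective_neighborChoice_le [DecidableEq V] (hG : G.IsTree) (U Q : Finset V)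
    (hUQ : U.card = Q.card + 1) :
    Nat.card {φ : U → Q // (∀ u : U, G.Adj (u : V) (φ u)) ∧ Function.Surjective φ} ≤ U.card := by
  classical
  obtain ⟨d, p, hp⟩ := exists_parent hG
  -- Two vertices with the same image cannot both be its parent, so one of them is sent to its own
  -- parent. Deleting that vertex leaves a bijection onto `Q`, and the deleted vertex will determine
  -- `φ`.
  have hex : ∀ φ : {φ : U → Q // (∀ u : U, G.Adj (u : V) (φ u)) ∧ Function.Surjective φ},
      ∃ u : U, p u = φ.1 u ∧ ∃ u', u' ≠ u ∧ φ.1 u' = φ.1 u := by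
    intro φ
    have hni : ¬ Function.Injective φ.1 := by
      intro hi
      have := Fintype.card_le_of_injective _ hi
      simp only [Fintype.card_coe] at this
      omega
    obtain ⟨u, u', e, hne⟩ : ∃ u u', φ.1 u = φ.1 u' ∧ u ≠ u' := by
      simpa [Function.Injective] using hni
    rcases hp _ _ (φ.2.1 u) with h | h
    · exact ⟨u, h.1, u', hne.symm, e.symm⟩
    rcases hp _ _ (φ.2.1 u') with h' | h'
    · exact ⟨u', h'.1, u, hne, e⟩
    · exact absurd (Subtype.ext (h.1.symm.trans ((congrArg (fun j : Q => p j) e).trans h'.1))) hne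
  choose F hF hF' using hex
  have hcard : Nat.card U = U.card := by simp
  rw [← hcard]
  refine Nat.card_le_card_of_injective F ?_
  have hinj : ∀ φ : {φ : U → Q // (∀ u : U, G.Adj (u : V) (φ u)) ∧ Function.Surjective φ},
      (∀ q, ∃ u, u ≠ F φ ∧ φ.1 u = q) ∧
      ∀ u u', u ≠ F φ → u' ≠ F φ → φ.1 u = φ.1 u' → u = u' := by
    intro φ
    have hsurj : ∀ q, ∃ u, u ≠ F φ ∧ φ.1 u = q := by
      intro q
      obtain ⟨u, rfl⟩ := φ.2.2 q
      by_cases h : u = F φ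
      · obtain ⟨u', h1, h2⟩ := hF' φ
        exact ⟨u', h1, by rw [h2, h]⟩
      · exact ⟨u, h, rfl⟩
    refine ⟨hsurj, ?_⟩
    have hbij : Function.Bijective fun u : {u : U // u ≠ F φ} => φ.1 u := by
      rw [Fintype.bijective_iff_surjective_and_card]
      refine ⟨fun q => ?_, ?_⟩
      · obtain ⟨u, hu, e⟩ := hsurj q
        exact ⟨⟨u, hu⟩, e⟩
      · rw [Fintype.card_subtype_compl]
        simp [hUQ]
    intro u u' hu hu' e
    have := @hbij.1 ⟨u, hu⟩ ⟨u', hu'⟩ e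
    simpa using this
  intro φ φ' e
  by_contra hne
  have hne' : φ.1 ≠ φ'.1 := fun h => hne (Subtype.ext h)
  obtain ⟨u₀, hu₀⟩ := Function.ne_iff.1 hne'
  set X : Finset U := Finset.univ.filter fun u => φ.1 u ≠ φ'.1 u
  have hX : ∀ u, u ∈ X ↔ φ.1 u ≠ φ'.1 u := by simp [X]
  have hXF : ∀ u, φ.1 u ≠ φ'.1 u → u ≠ F φ := by
    rintro u hu rfl
    refine hu (Subtype.ext ?_)
    rw [← hF φ, e, hF φ']
  have hXF' : ∀ u, φ.1 u ≠ φ'.1 u → u ≠ F φ' := fun u hu => e ▸ hXF u hu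
  -- Two matchings of the same vertex sets in a forest coincide: otherwise every vertex where they
  -- differ has two distinct neighbours in `S`, which contradicts `exists_leaf`.
  set S : Finset V := X.image (fun u : U => (u : V)) ∪ X.image (fun u : U => (φ.1 u : V))
  have hSl : ∀ u, φ.1 u ≠ φ'.1 u → (u : V) ∈ S := fun u hu =>
    Finset.mem_union_left _ (Finset.mem_image_of_mem (fun u : U => (u : V)) ((hX u).2 hu))
  have hSr : ∀ u, φ.1 u ≠ φ'.1 u → (φ.1 u : V) ∈ S := fun u hu =>
    Finset.mem_union_right _ (Finset.mem_image_of_mem (fun u : U => (φ.1 u : V)) ((hX u).2 hu))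
  have hSr' : ∀ u, φ.1 u ≠ φ'.1 u → (φ'.1 u : V) ∈ S := by
    intro u hu
    obtain ⟨x', hx', e'⟩ := (hinj φ).1 (φ'.1 u)
    rw [← e']
    refine hSr x' fun h => ?_
    have := (hinj φ').2 x' u (e ▸ hx') (hXF' u hu) (h.symm.trans e')
    subst this
    exact hu e'
  obtain ⟨v, hv, hleaf⟩ := exists_leaf hG ⟨_, hSl u₀ hu₀⟩
  rcases Finset.mem_union.1 hv with hv | hv
  · obtain ⟨u, hu, rfl⟩ := Finset.mem_image.1 hv
    rw [hX] at hu
    exact hu (Subtype.ext (hleaf _ (hSr u hu) _ (hSr' u hu) (φ.2.1 u) (φ'.2.1 u)))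
  · obtain ⟨u, hu, rfl⟩ := Finset.mem_image.1 hv
    rw [hX] at hu
    obtain ⟨x', hx', e'⟩ := (hinj φ').1 (φ.1 u)
    have hx : φ.1 x' ≠ φ'.1 x' := by
      intro h
      have := (hinj φ).2 x' u (e.symm ▸ hx') (hXF u hu) (h.trans e')
      subst this
      exact hu h
    have h1 := hleaf _ (hSl u hu) _ (hSl x' hx) (φ.2.1 u).symm
      (by have := (φ'.2.1 x').symm; rwa [e'] at this)
    have h2 : u = x' := Subtype.ext h1
    subst h2
    exact hx e'.symm

/-- The number of surjective layerings with values in `Fin s`. -/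
def surjectiveLayerings (G : SimpleGraph V) (A : Finset V) (s : ℕ) : ℕ :=
  Nat.card {ψ : V → Fin s // IsLayering G A ψ ∧ Function.Surjective ψ}

/-- A surjection is recovered from a section, an embedding of `Fin r`, together with its values off
the image of the section. -/
theorem card_surjective_le (α : Type*) [Fintype α] (r : ℕ) :
    Nat.card {f : α → Fin r // Function.Surjective f} ≤
      r ^ (Fintype.card α - r) * (Fintype.card α).descFactorial r := by
  classical
  have hcard : Nat.card (Σ ι : Fin r ↪ α, ({x // x ∉ Set.range ι} → Fin r)) =
      r ^ (Fintype.card α - r) * (Fintype.card α).descFactorial r := by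
    rw [Nat.card_eq_fintype_card, Fintype.card_sigma]
    have : ∀ ι : Fin r ↪ α, Fintype.card ({x // x ∉ Set.range ι} → Fin r) =
        r ^ (Fintype.card α - r) := by
      intro ι
      rw [Fintype.card_fun, Fintype.card_fin, Fintype.card_subtype_compl]
      congr 2
      exact (Fintype.card_congr (Equiv.ofInjective ι ι.injective)).symm.trans (Fintype.card_fin r)
    rw [Finset.sum_congr rfl fun ι _ => this ι, Finset.sum_const, Finset.card_univ,
      Fintype.card_embedding_eq, Fintype.card_fin, smul_eq_mul, mul_comm]
  rw [← hcard]
  refine Nat.card_le_card_of_injective (fun f =>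
    ⟨⟨Function.surjInv f.2, Function.injective_surjInv f.2⟩, fun x => f.1 x⟩) ?_
  intro f g e
  simp only [Sigma.mk.injEq] at e
  obtain ⟨e1, e2⟩ := e
  have e1' : Function.surjInv f.2 = Function.surjInv g.2 := congrArg DFunLike.coe e1
  refine Subtype.ext (funext fun x => ?_)
  by_cases hx : x ∈ Set.range (Function.surjInv f.2)
  · obtain ⟨l, rfl⟩ := hx
    refine (Function.surjInv_eq f.2 l).trans ?_
    rw [e1']
    exact (Function.surjInv_eq g.2 l).symm
  · have key : ∀ (ι ι' : Fin r ↪ α) (a : {x // x ∉ Set.range ι} → Fin r)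
        (b : {x // x ∉ Set.range ι'} → Fin r), ι = ι' → HEq a b →
        ∀ x (h : x ∉ Set.range ι) (h' : x ∉ Set.range ι'), a ⟨x, h⟩ = b ⟨x, h'⟩ := by
      rintro ι _ a b rfl hab x h h'
      rw [eq_of_heq hab]
    exact key _ _ _ _ e1 e2 x hx (fun h => hx (by rw [e1']; exact h))

theorem surjectiveLayerings_le [Fintype V] {A : Finset V}
    (hA : ∀ v w, G.Adj v w → (v ∈ A ↔ w ∉ A)) (r : ℕ) :
    surjectiveLayerings G A r ≤ r ^ (A.card - r) * A.card.descFactorial r := by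
  classical
  have h := card_surjective_le A r
  rw [Fintype.card_coe] at h
  have hsurj : ∀ ψ : {ψ : V → Fin r // IsLayering G A ψ ∧ Function.Surjective ψ},
      Function.Surjective fun i : A => ψ.1 i := by
    intro ψ t
    obtain ⟨v, hv⟩ := ψ.2.2 t
    by_cases hvA : v ∈ A
    · exact ⟨⟨v, hvA⟩, hv⟩
    · obtain ⟨w, hw, e⟩ := ψ.2.1.tight v
      exact ⟨⟨w, by_contra fun h => hvA ((hA v w hw).2 h)⟩, e.trans hv⟩
  refine le_trans (Nat.card_le_card_of_injective
    (fun ψ => (⟨_, hsurj ψ⟩ : {f : A → Fin r // Function.Surjective f})) fun ψ ψ' e => ?_) h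
  refine Subtype.ext (ψ.2.1.eq_of_eqOn hA ψ'.2.1 fun i hi => ?_)
  exact congrFun (congrArg Subtype.val e) ⟨i, hi⟩

/-- A surjective layering with as many values as a vertex cover `W` has elements is determined by
its restriction to `W`, together with a surjective choice of neighbours `A \ W → W \ A`. -/
theorem surjectiveLayerings_le_factorial_mul [Fintype V] [DecidableEq V] {A W : Finset V}
    (hA : ∀ v w, G.Adj v w → (v ∈ A ↔ w ∉ A)) (hW : ∀ u v, G.Adj u v → u ∈ W ∨ v ∈ W) :
    surjectiveLayerings G A W.card ≤ W.card.factorial *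
      Nat.card {φ : (A \ W : Finset V) → (W \ A : Finset V) //
        (∀ u : (A \ W : Finset V), G.Adj (u : V) (φ u)) ∧ Function.Surjective φ} := by
  classical
  have hfac : Nat.card (W ↪ Fin W.card) = W.card.factorial := by
    rw [Nat.card_eq_fintype_card, Fintype.card_embedding_eq]
    simp [Nat.descFactorial_self]
  rw [← hfac, ← Nat.card_prod]
  -- All `W.card` values occur on `W`, so the restriction to `W` is a bijection.
  have hinj : ∀ ψ : {ψ : V → Fin W.card // IsLayering G A ψ ∧ Function.Surjective ψ},
      Function.Injective fun w : W => ψ.1 w := by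
    intro ψ
    have : Function.Bijective fun w : W => ψ.1 w := by
      rw [Fintype.bijective_iff_surjective_and_card]
      refine ⟨fun t => ?_, by simp⟩
      obtain ⟨v, rfl⟩ := ψ.2.2 t
      obtain ⟨w, hw, e⟩ := ψ.2.1.exists_mem_cover hW v
      exact ⟨⟨w, hw⟩, e⟩
    exact this.1
  have hφ : ∀ (ψ : {ψ : V → Fin W.card // IsLayering G A ψ ∧ Function.Surjective ψ})
      (u : (A \ W : Finset V)), ∃ w : (W \ A : Finset V), G.Adj (u : V) w ∧ ψ.1 w = ψ.1 u := by
    intro ψ u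
    obtain ⟨hu, hu'⟩ := Finset.mem_sdiff.1 u.2
    obtain ⟨w, hw, e⟩ := ψ.2.1.tight u
    exact ⟨⟨w, Finset.mem_sdiff.2 ⟨(hW _ _ hw).resolve_left hu', (hA _ _ hw).1 hu⟩⟩, hw, e⟩
  choose φ hφ hφ' using hφ
  refine Nat.card_le_card_of_injective
    (fun ψ => (⟨fun w => ψ.1 w, hinj ψ⟩, ⟨φ ψ, hφ ψ, fun w => ?_⟩)) ?_
  · obtain ⟨hw, hw'⟩ := Finset.mem_sdiff.1 w.2
    obtain ⟨u, hu, e⟩ := ψ.2.1.tight w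
    have huA : u ∈ A := by_contra fun h => hw' ((hA _ _ hu).2 h)
    -- A constant edge cannot have both ends in `W`, where `ψ` is injective. This makes the
    -- neighbour choice surjective.
    have huW : u ∉ W := by
      intro huW
      have := @hinj ψ ⟨u, huW⟩ ⟨w, hw⟩ e
      exact hu.ne (congrArg Subtype.val this).symm
    refine ⟨⟨u, Finset.mem_sdiff.2 ⟨huA, huW⟩⟩, ?_⟩
    have h1 := (hφ' ψ ⟨u, Finset.mem_sdiff.2 ⟨huA, huW⟩⟩).trans e
    have := @hinj ψ ⟨_, (Finset.mem_sdiff.1 (φ ψ _).2).1⟩ ⟨w, hw⟩ h1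
    exact Subtype.ext (congrArg (fun z : W => (z : V)) this)
  · intro ψ ψ' e
    simp only [Prod.mk.injEq, Subtype.mk.injEq] at e
    have e1 : ∀ w ∈ W, ψ.1 w = ψ'.1 w := fun w hw =>
      congrFun (congrArg DFunLike.coe e.1) ⟨w, hw⟩
    refine Subtype.ext (ψ.2.1.eq_of_eqOn hA ψ'.2.1 fun i hi => ?_)
    by_cases hiW : i ∈ W
    · exact e1 i hiW
    · have hi' : i ∈ A \ W := Finset.mem_sdiff.2 ⟨hi, hiW⟩
      have h1 := hφ' ψ ⟨i, hi'⟩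
      have h2 := hφ' ψ' ⟨i, hi'⟩
      rw [← e.2] at h2
      exact h1.symm.trans ((e1 _ (Finset.mem_sdiff.1 (φ ψ ⟨i, hi'⟩).2).1).trans h2)

/-- When `A.card - W.card ≥ 2`, the bound by powers of `2` on neighbour choices suffices. When the
difference is `1`, that bound is too weak, but then `A \ W` has one element more than `W \ A` and
the sharper count of surjective choices applies. -/
theorem surjectiveLayerings_le_of_lt [Fintype V] [DecidableEq V] (hG : G.IsTree) {A W : Finset V}
    (hA : ∀ v w, G.Adj v w → (v ∈ A ↔ w ∉ A)) (hW : ∀ u v, G.Adj u v → u ∈ W ∨ v ∈ W)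
    (hlt : W.card < A.card) :
    surjectiveLayerings G A W.card ≤
      (A.card - W.card) ^ W.card * A.card.descFactorial W.card := by
  refine (surjectiveLayerings_le_factorial_mul hA hW).trans ?_
  have hc1 := Finset.card_sdiff_add_card_inter A W
  have hc2 := Finset.card_sdiff_add_card_inter W A
  rw [Finset.inter_comm] at hc2
  by_cases h1 : A.card = W.card + 1
  · have hle := card_surjective_neighborChoice_le hG (A \ W) (W \ A) (by omega)
    have h2 := Nat.factorial_mul_descFactorial hlt.le
    have h3 : A.card - W.card = 1 := by omega
    rw [h3, Nat.factorial_one, one_mul, h1, Nat.factorial_succ] at h2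
    rw [h3, one_pow, one_mul, h1, h2, mul_comm (W.card + 1)]
    exact Nat.mul_le_mul_left _ (by omega)
  · have hle : Nat.card {φ : (A \ W : Finset V) → (W \ A : Finset V) //
        (∀ u : (A \ W : Finset V), G.Adj (u : V) (φ u)) ∧ Function.Surjective φ} ≤ 2 ^ (W \ A).card := by
      refine le_trans ?_ (card_neighborChoice_le hG (A \ W) (W \ A))
      exact Nat.card_le_card_of_injective (fun φ => ⟨φ.1, φ.2.1⟩) fun φ φ' e =>
        Subtype.ext (by simpa using e)
    rw [mul_comm]
    refine Nat.mul_le_mul (hle.trans ?_) ?_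
    · calc 2 ^ (W \ A).card ≤ 2 ^ W.card := Nat.pow_le_pow_right (by norm_num) (by omega)
        _ ≤ _ := Nat.pow_le_pow_left (by omega) _
    · rw [← Nat.descFactorial_self]
      exact Nat.descFactorial_le _ hlt.le

/-- Every good initial segment of a standard drawing has at most as many positions as a vertex
cover has elements. -/
theorem StandardDrawing.Good.le_card_cover {Γ : StandardDrawing G} {s : ℕ} (h : Γ.Good s)
    {W : Finset V} (hW : ∀ u v, G.Adj u v → u ∈ W ∨ v ∈ W) : s ≤ W.card := by
  classical
  have hab := Γ.a_le_b
  have hex : ∀ l : Fin s, ∃ w ∈ W, w = Γ.vertex (Sum.inl ⟨l, by have := h.1; omega⟩) ∨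
      w = Γ.vertex (Sum.inr ⟨l, by have := h.1; omega⟩) := by
    intro l
    rcases hW _ _ (h.2.1 ⟨l, by have := h.1; omega⟩ ⟨l, by have := h.1; omega⟩ l.2 rfl) with h | h
    exacts [⟨_, h, Or.inl rfl⟩, ⟨_, h, Or.inr rfl⟩]
  choose f hf hf' using hex
  have hinj : Function.Injective fun l => (⟨f l, hf l⟩ : W) := by
    intro l m e
    have e : f l = f m := congrArg Subtype.val e
    rcases hf' l with h1 | h1 <;> rcases hf' m with h2 | h2 <;>
      · rw [h1, h2] at e
        exact Fin.ext (by simpa using Γ.vertex.injective e)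
  simpa using Fintype.card_le_of_injective _ hinj

theorem StandardDrawing.r_le_card_cover (Γ : StandardDrawing G)
    {W : Finset V} (hW : ∀ u v, G.Adj u v → u ∈ W ∨ v ∈ W) : Γ.r ≤ W.card :=
  csSup_le' fun _ hs => StandardDrawing.Good.le_card_cover hs hW

theorem IsOrderedMatchingCover.exists_standardDrawing [Fintype V] [DecidableEq V]
    {A B W : Finset V} {x y : Fin W.card → V} (h : IsOrderedMatchingCover G A W x y)
    (hunion : A ∪ B = Finset.univ) (hbip : G.IsBipartiteWith (A : Set V) (B : Set V))
    (hcard : A.card ≤ B.card) : ∃ Γ : StandardDrawing G, Γ.Good W.card := by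
  classical
  have hdisj : Disjoint A B := Finset.disjoint_coe.1 hbip.disjoint
  have hy : ∀ l, y l ∈ B := fun l => by
    have := hbip.mem_of_mem_adj (h.mem l) (h.adj l)
    simpa using this
  have hWA : W.card ≤ A.card := by
    have := Finset.card_le_card_of_injOn (s := Finset.univ) (t := A) x (fun l _ => h.mem l)
      h.injective_fst.injOn
    simpa using this
  have ext : ∀ (C : Finset V) (z : Fin W.card → V), (∀ l, z l ∈ C) → Function.Injective z →
      ∃ g : Fin C.card ≃ C, ∀ (i : Fin C.card) (hi : (i : ℕ) < W.card), (g i : V) = z ⟨i, hi⟩ := by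
    intro C z hz hzi
    -- Positivity supplies `z ⟨0, hpos⟩`, an irrelevant default outside the initial segment on which
    -- `z` is prescribed.
    rcases Nat.eq_zero_or_pos W.card with h0 | hpos
    · exact ⟨C.equivFin.symm, fun i hi => by omega⟩
    obtain ⟨g, hg⟩ := Finset.exists_equiv_extend_of_card_eq (α := Fin C.card) (t := C) (by simp)
      (s := Finset.univ.filter fun i : Fin C.card => (i : ℕ) < W.card)
      (f := fun i => if hi : (i : ℕ) < W.card then z ⟨i, hi⟩ else z ⟨0, hpos⟩) (by
        intro v hv
        obtain ⟨i, hi, rfl⟩ := Finset.mem_image.1 hv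
        have hi : (i : ℕ) < W.card := by simpa using hi
        rw [dif_pos hi]
        exact hz _) (by
        intro i hi j hj e
        have hi : (i : ℕ) < W.card := by simpa using hi
        have hj : (j : ℕ) < W.card := by simpa using hj
        simp only [dif_pos hi, dif_pos hj] at e
        have := hzi e
        simpa [Fin.ext_iff] using this)
    refine ⟨g, fun i hi => ?_⟩
    rw [hg i (by simpa using hi), dif_pos hi]
  obtain ⟨g, hg⟩ := ext A x h.mem h.injective_fst
  obtain ⟨g', hg'⟩ := ext B y hy h.injective_snd
  have hbij : Function.Bijective (Sum.elim (fun i => (g i : V)) (fun j => (g' j : V))) := by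
    constructor
    · rw [Sum.elim_injective]
      refine ⟨Subtype.val_injective.comp g.injective, Subtype.val_injective.comp g'.injective, ?_⟩
      intro i j e
      exact Finset.disjoint_left.1 hdisj (g i).2 (e ▸ (g' j).2)
    · intro v
      rcases Finset.mem_union.1 (hunion ▸ Finset.mem_univ v) with hv | hv
      · exact ⟨Sum.inl (g.symm ⟨v, hv⟩), by simp⟩
      · exact ⟨Sum.inr (g'.symm ⟨v, hv⟩), by simp⟩
  refine ⟨⟨A.card, B.card, hcard, Equiv.ofBijective _ hbij, ?_, ?_⟩, hWA, ?_, ?_⟩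
  · intro i j hadj
    have := hbip.mem_of_mem_adj (g i).2 hadj
    exact Finset.disjoint_left.1 hdisj (g j).2 (by simpa using this)
  · intro i j hadj
    have := hbip.symm.mem_of_mem_adj (g' i).2 hadj
    exact Finset.disjoint_left.1 hdisj (by simpa using this) (g' j).2
  · intro i j hi hij
    simp only [StandardDrawing.Edge, Equiv.ofBijective_apply, Sum.elim_inl, Sum.elim_inr]
    rw [hg i hi, hg' j (by omega)]
    have : (⟨j, by omega⟩ : Fin W.card) = ⟨i, hi⟩ := Fin.ext hij
    rw [this]
    exact h.adj _
  · intro i j hi hij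
    simp only [StandardDrawing.Edge, Equiv.ofBijective_apply, Sum.elim_inl, Sum.elim_inr]
    rw [hg i hi, hg' j (by omega)]
    exact h.not_adj _ _ hij

theorem IsOrderedMatchingCover.gdim_eq [Fintype V] [DecidableEq V]
    {A B W : Finset V} {x y : Fin W.card → V} (h : IsOrderedMatchingCover G A W x y)
    (hunion : A ∪ B = Finset.univ) (hbip : G.IsBipartiteWith (A : Set V) (B : Set V))
    (hcard : A.card ≤ B.card) : gdim G = 1 + W.card := by
  obtain ⟨Γ, hΓ⟩ := h.exists_standardDrawing hunion hbip hcard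
  have hle : W.card ≤ Γ.r :=
    le_csSup ⟨W.card, fun _ hs => StandardDrawing.Good.le_card_cover hs h.cover⟩ hΓ
  have hbdd : W.card ∈ upperBounds (Set.range fun Γ : StandardDrawing G => Γ.r) := by
    rintro _ ⟨Γ, rfl⟩
    exact Γ.r_le_card_cover h.cover
  rw [gdim]
  congr 1
  exact le_antisymm (csSup_le' hbdd) (hle.trans (le_csSup ⟨_, hbdd⟩ ⟨Γ, rfl⟩))

end Trees

/-! ### The number of layerings as a polynomial, and its leading coefficient. -/

section Counting

variable {V : Type v} {G : SimpleGraph V}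

/-- The number of layerings with values in `Fin n`. -/
def layerings (G : SimpleGraph V) (A : Finset V) (n : ℕ) : ℕ :=
  Nat.card {ψ : V → Fin n // IsLayering G A ψ}

/-- Being a layering depends only on the order of the values, so the value set `I` can be relabelled
increasingly by `Fin I.card`. -/
theorem card_layerings_image_eq [Fintype V] (A : Finset V) {n : ℕ} (I : Finset (Fin n)) :
    Nat.card {ψ : {ψ : V → Fin n // IsLayering G A ψ} // Finset.univ.image ψ.1 = I} =
      surjectiveLayerings G A I.card := by
  classical
  symm
  have hrange : ∀ t, t ∈ I ↔ ∃ l, I.orderEmbOfFin rfl l = t := by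
    intro t
    rw [← Set.mem_range, Finset.range_orderEmbOfFin]
    rfl
  refine Nat.card_congr (Equiv.ofBijective (fun χ => ⟨⟨I.orderEmbOfFin rfl ∘ χ.1,
    χ.2.1.comp_monotone (I.orderEmbOfFin rfl).monotone⟩, ?_⟩) ⟨?_, ?_⟩)
  · ext t
    rw [hrange]
    simp only [Finset.mem_image, Finset.mem_univ, true_and, Function.comp_apply]
    constructor
    · rintro ⟨v, e⟩
      exact ⟨_, e⟩
    · rintro ⟨l, e⟩
      obtain ⟨v, rfl⟩ := χ.2.2 l
      exact ⟨v, e⟩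
  · intro χ χ' e
    have e : I.orderEmbOfFin rfl ∘ χ.1 = I.orderEmbOfFin rfl ∘ χ'.1 :=
      congrArg (fun ψ => ψ.1.1) e
    exact Subtype.ext ((I.orderEmbOfFin rfl).injective.comp_left e)
  · rintro ⟨⟨ψ, hψ⟩, hI⟩
    have hmem : ∀ v, ∃ l, I.orderEmbOfFin rfl l = ψ v := fun v => by
      rw [← hrange, ← hI]
      exact Finset.mem_image_of_mem _ (Finset.mem_univ v)
    choose χ hχ using hmem
    have hcomp : I.orderEmbOfFin rfl ∘ χ = ψ := funext hχ
    refine ⟨⟨χ, .of_comp_strictMono (I.orderEmbOfFin rfl).strictMono (hcomp ▸ hψ), ?_⟩,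
      Subtype.ext (Subtype.ext hcomp)⟩
    intro l
    have hl : I.orderEmbOfFin rfl l ∈ Finset.univ.image ψ := hI ▸ (hrange _).2 ⟨l, rfl⟩
    obtain ⟨v, -, e⟩ := Finset.mem_image.1 hl
    exact ⟨v, (I.orderEmbOfFin rfl).injective ((hχ v).trans e)⟩

theorem layerings_eq_sum [Fintype V] (A : Finset V) (n : ℕ) :
    layerings G A n = ∑ s ∈ Finset.range (n + 1), n.choose s * surjectiveLayerings G A s := by
  classical
  have h := Nat.card_congr
    (Equiv.sigmaFiberEquiv fun ψ : {ψ : V → Fin n // IsLayering G A ψ} => Finset.univ.image ψ.1)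
  rw [layerings, ← h, Nat.card_sigma,
    Finset.sum_congr rfl fun I _ => card_layerings_image_eq (G := G) A I]
  have := Finset.sum_powerset_apply_card (surjectiveLayerings G A) (x := (Finset.univ : Finset (Fin n)))
  simpa using this

theorem surjectiveLayerings_eq_zero {A W : Finset V} (hW : ∀ u v, G.Adj u v → u ∈ W ∨ v ∈ W)
    {s : ℕ} (hs : W.card < s) : surjectiveLayerings G A s = 0 := by
  have : IsEmpty {ψ : V → Fin s // IsLayering G A ψ ∧ Function.Surjective ψ} := by
    refine ⟨fun ψ => ?_⟩
    have hsurj : Function.Surjective fun w : W => ψ.1 w := by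
      intro t
      obtain ⟨v, rfl⟩ := ψ.2.2 t
      obtain ⟨w, hw, e⟩ := ψ.2.1.exists_mem_cover hW v
      exact ⟨⟨w, hw⟩, e⟩
    have := Fintype.card_le_of_surjective _ hsurj
    simp only [Fintype.card_fin, Fintype.card_coe] at this
    omega
  exact Nat.card_of_isEmpty

theorem layerings_eq_sum_range_card_cover [Fintype V] {A W : Finset V}
    (hW : ∀ u v, G.Adj u v → u ∈ W ∨ v ∈ W) (n : ℕ) :
    layerings G A n =
      ∑ s ∈ Finset.range (W.card + 1), n.choose s * surjectiveLayerings G A s := by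
  rw [layerings_eq_sum]
  -- Both sums are extended to a common range: the binomial coefficients vanish beyond `n`, the
  -- surjective counts beyond `W.card`.
  have h1 := Finset.sum_subset (Finset.range_mono (show n + 1 ≤ n + W.card + 1 by omega))
    (f := fun s => n.choose s * surjectiveLayerings G A s) (fun s _ hs => by
      rw [Nat.choose_eq_zero_of_lt (by simpa using hs), zero_mul])
  have h2 := Finset.sum_subset (Finset.range_mono (show W.card + 1 ≤ n + W.card + 1 by omega))
    (f := fun s => n.choose s * surjectiveLayerings G A s) (fun s _ hs => by
      rw [surjectiveLayerings_eq_zero hW (by simpa using hs), mul_zero])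
  rw [h1, h2]

theorem exists_layerings_le [Fintype V] {A W : Finset V}
    (hW : ∀ u v, G.Adj u v → u ∈ W ∨ v ∈ W) :
    ∃ C, ∀ n, 0 < n → layerings G A n ≤ C * n ^ W.card := by
  refine ⟨∑ s ∈ Finset.range (W.card + 1), surjectiveLayerings G A s, fun n hn => ?_⟩
  rw [layerings_eq_sum_range_card_cover hW, Finset.sum_mul]
  refine Finset.sum_le_sum fun s hs => ?_
  rw [mul_comm]
  refine Nat.mul_le_mul_left _ ((Nat.choose_le_pow n s).trans ?_)
  exact Nat.pow_le_pow_right hn (Nat.lt_succ_iff.1 (Finset.mem_range.1 hs))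

theorem tendsto_choose_succ_div_pow {s r : ℕ} (hs : s ≤ r) :
    Tendsto (fun k : ℕ => ((k + 1).choose s : ℝ) / (k : ℝ) ^ r) atTop
      (𝓝 (if s = r then 1 / (r.factorial : ℝ) else 0)) := by
  have h1 : Tendsto (fun n : ℕ => (n.choose s : ℝ) / (n : ℝ) ^ s) atTop
      (𝓝 (1 / (s.factorial : ℝ))) := by
    have hne : ∀ᶠ n : ℕ in atTop, ((n : ℝ) ^ s / s.factorial : ℝ) ≠ 0 := by
      filter_upwards [eventually_gt_atTop 0] with n hn
      positivity
    have := ((Asymptotics.isEquivalent_iff_tendsto_one hne).1 (isEquivalent_choose s)).mul_const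
      (1 / (s.factorial : ℝ))
    rw [one_mul] at this
    refine this.congr' ?_
    filter_upwards [eventually_gt_atTop 0] with n hn
    simp only [Pi.div_apply]
    field_simp
  have h2 : Tendsto (fun k : ℕ => (((k + 1 : ℕ) : ℝ) / k) ^ s) atTop (𝓝 1) := by
    have : Tendsto (fun k : ℕ => 1 + 1 / (k : ℝ)) atTop (𝓝 (1 + 0)) :=
      tendsto_const_nhds.add tendsto_one_div_atTop_nhds_zero_nat
    have := (this.pow s)
    rw [add_zero, one_pow] at this
    refine this.congr' ?_
    filter_upwards [eventually_gt_atTop 0] with k hk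
    congr 1
    push_cast
    field_simp
  have h3 : Tendsto (fun k : ℕ => (1 / (k : ℝ)) ^ (r - s)) atTop
      (𝓝 (if s = r then 1 else 0)) := by
    split_ifs with h
    · subst h
      simp
    · have := (tendsto_one_div_atTop_nhds_zero_nat (𝕜 := ℝ)).pow (r - s)
      rwa [zero_pow (by omega)] at this
  have h4 := ((h1.comp (tendsto_add_atTop_nat 1)).mul h2).mul h3
  have e : (1 / (s.factorial : ℝ) * 1 * if s = r then 1 else 0) =
      if s = r then 1 / (r.factorial : ℝ) else 0 := by
    split_ifs with h
    · subst h; simp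
    · simp
  rw [e] at h4
  refine h4.congr' ?_
  filter_upwards [eventually_gt_atTop 0] with k hk
  have hk' : (k : ℝ) ≠ 0 := by positivity
  have hr : (k : ℝ) ^ r = (k : ℝ) ^ s * (k : ℝ) ^ (r - s) := by
    rw [← pow_add]; congr 1; omega
  simp only [Function.comp_apply]
  rw [hr, div_pow, div_pow]
  have : ((k + 1 : ℕ) : ℝ) ≠ 0 := by positivity
  field_simp
  simp

theorem tendsto_layerings [Fintype V] {A W : Finset V}
    (hW : ∀ u v, G.Adj u v → u ∈ W ∨ v ∈ W) :
    Tendsto (fun k : ℕ => (W.card.factorial : ℝ) * (layerings G A (k + 1) : ℝ) /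
      (k : ℝ) ^ W.card) atTop (𝓝 (surjectiveLayerings G A W.card : ℝ)) := by
  have h : Tendsto (fun k : ℕ => ∑ s ∈ Finset.range (W.card + 1),
      (((k + 1).choose s : ℝ) / (k : ℝ) ^ W.card) *
        ((W.card.factorial : ℝ) * surjectiveLayerings G A s)) atTop
      (𝓝 (∑ s ∈ Finset.range (W.card + 1),
        (if s = W.card then 1 / (W.card.factorial : ℝ) else 0) *
          ((W.card.factorial : ℝ) * surjectiveLayerings G A s))) :=
    tendsto_finsetSum _ fun s hs => (tendsto_choose_succ_div_pow
      (Nat.lt_succ_iff.1 (Finset.mem_range.1 hs))).mul_const _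
  have e : (∑ s ∈ Finset.range (W.card + 1),
        (if s = W.card then 1 / (W.card.factorial : ℝ) else 0) *
          ((W.card.factorial : ℝ) * surjectiveLayerings G A s)) =
      surjectiveLayerings G A W.card := by
    rw [Finset.sum_eq_single W.card (fun s _ hs => by simp [hs]) (by simp), if_pos rfl]
    have : (W.card.factorial : ℝ) ≠ 0 := by positivity
    field_simp
  rw [e] at h
  refine h.congr fun k => ?_
  rw [layerings_eq_sum_range_card_cover hW]
  push_cast
  rw [Finset.mul_sum, Finset.sum_div]
  exact Finset.sum_congr rfl fun s _ => by ring

end Counting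

/-! ### Basic covers and their correspondence with layerings. -/

section BasicCovers

variable {V : Type v} {G : SimpleGraph V}

theorem IsCover.add {c c' : Option V →₀ ℕ} (h : IsCover G c) (h' : IsCover G c') :
    IsCover G (c + c') := by
  intro i j hij
  have := h i j hij
  have := h' i j hij
  simp only [Finsupp.add_apply]
  omega

theorem isCover_zero : IsCover G (0 : Option V →₀ ℕ) := fun i j _ => by simp

/-- A basic cover: a `k`-cover which is not the sum of a `k`-cover and a unit vector. -/
def IsBasic (G : SimpleGraph V) (c : Option V →₀ ℕ) : Prop :=
  IsCover G c ∧ ∀ c' v, IsCover G c' → c ≠ c' + Finsupp.single (some v) 1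

/-- A positive entry can be lowered by one exactly when no edge at its vertex is tight. -/
theorem isBasic_iff (hdeg : ∀ v, ∃ w, G.Adj v w) (c : Option V →₀ ℕ) :
    IsBasic G c ↔ IsCover G c ∧
      ∀ v, ∃ w, G.Adj v w ∧ c (some v) + c (some w) = c none := by
  classical
  constructor
  · rintro ⟨hc, h⟩
    have key : ∀ v, c (some v) ≠ 0 → ∃ w, G.Adj v w ∧ c (some v) + c (some w) = c none := by
      intro v hv
      by_contra! hn
      refine h (c - Finsupp.single (some v) 1) v ?_ ?_
      · intro i j hij
        have h1 := hc i j hij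
        have hne := hij.ne
        by_cases hi : i = v
        · subst hi
          have h2 := hn j hij
          simp only [Finsupp.tsub_apply, Finsupp.single_apply, Option.some.injEq, hne, if_true,
            if_false, reduceCtorEq]
          omega
        · by_cases hj : j = v
          · subst hj
            have h2 := hn i hij.symm
            simp only [Finsupp.tsub_apply, Finsupp.single_apply, Option.some.injEq, hne.symm,
              if_true, if_false, reduceCtorEq]
            omega
          · simp only [Finsupp.tsub_apply, Finsupp.single_apply, Option.some.injEq, Ne.symm hi,
              Ne.symm hj, if_false, reduceCtorEq]
            omega
      · ext o
        by_cases ho : some v = o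
        · subst ho
          simp only [Finsupp.add_apply, Finsupp.tsub_apply, Finsupp.single_eq_same]
          omega
        · simp [ho]
    refine ⟨hc, fun v => ?_⟩
    -- A zero entry cannot be lowered, so its tight edge comes from a neighbour `w`: if `w` has a
    -- positive entry, a tight edge at `w` gives `c (some w) ≤ c none`, and the cover condition on
    -- `vw` gives the reverse inequality.
    by_cases hv : c (some v) = 0
    · obtain ⟨w, hw⟩ := hdeg v
      refine ⟨w, hw, ?_⟩
      have h1 := hc v w hw
      by_cases hw0 : c (some w) = 0
      · omega
      · obtain ⟨u, hu, e⟩ := key w hw0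
        have := hc v w hw
        omega
    · exact key v hv
  · rintro ⟨hc, h⟩
    refine ⟨hc, ?_⟩
    rintro c' v hc' rfl
    obtain ⟨w, hw, e⟩ := h v
    have := hc' v w hw
    have hne := hw.ne
    simp only [Finsupp.add_apply, Finsupp.single_apply, Option.some.injEq, hne, if_true,
      if_false, reduceCtorEq] at e
    omega

theorem IsBasic.apply_le (hdeg : ∀ v, ∃ w, G.Adj v w) {c : Option V →₀ ℕ} (h : IsBasic G c)
    (v : V) : c (some v) ≤ c none := by
  obtain ⟨w, -, e⟩ := ((isBasic_iff hdeg c).1 h).2 v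
  omega

variable [Fintype V] [DecidableEq V]

/-- The exponent vector with `t`-exponent `k` which agrees with `ψ` on `A` and with `k - ψ`
elsewhere. -/
def toCover (A : Finset V) (k : ℕ) (ψ : V → ℕ) : Option V →₀ ℕ :=
  Finsupp.equivFunOnFinite.symm fun o => o.elim k fun v => if v ∈ A then ψ v else k - ψ v

@[simp]
theorem toCover_none (A : Finset V) (k : ℕ) (ψ : V → ℕ) : toCover A k ψ none = k := rfl

theorem toCover_some (A : Finset V) (k : ℕ) (ψ : V → ℕ) (v : V) :
    toCover A k ψ (some v) = if v ∈ A then ψ v else k - ψ v := rfl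

theorem toCover_zero (A : Finset V) : toCover A 0 0 = 0 := by
  ext o
  cases o <;> simp [toCover_some]

/-- Flipping the entries off `A` is an involution on vectors bounded by the degree, so the same
formula recovers the layering from a cover. -/
theorem toCover_toCover (A : Finset V) (c : Option V →₀ ℕ) (hc : ∀ v, c (some v) ≤ c none) :
    toCover A (c none) (fun v => toCover A (c none) (fun w => c (some w)) (some v)) = c := by
  ext o
  cases o with
  | none => rfl
  | some v =>
    have := hc v
    simp only [toCover_some]
    split_ifs <;> omega

theorem toCover_tight_iff {A : Finset V} (hA : ∀ v w, G.Adj v w → (v ∈ A ↔ w ∉ A)) {k : ℕ}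
    {ψ : V → ℕ} (hψ : ∀ v, ψ v ≤ k) {v w : V} (hvw : G.Adj v w) :
    toCover A k ψ (some v) + toCover A k ψ (some w) = toCover A k ψ none ↔ ψ w = ψ v := by
  have h1 := hA v w hvw
  have h2 := hψ v
  have h3 := hψ w
  simp only [toCover_some, toCover_none]
  by_cases hv : v ∈ A
  · rw [if_pos hv, if_neg (h1.1 hv)]; omega
  · rw [if_neg hv, if_pos (by_contra fun h => hv (h1.2 h))]; omega

theorem isBasic_toCover_iff {A : Finset V} (hA : ∀ v w, G.Adj v w → (v ∈ A ↔ w ∉ A))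
    (hdeg : ∀ v, ∃ w, G.Adj v w) {k : ℕ} {ψ : V → ℕ} (hψ : ∀ v, ψ v ≤ k) :
    IsBasic G (toCover A k ψ) ↔ IsLayering G A ψ := by
  rw [isBasic_iff hdeg]
  constructor
  · rintro ⟨h1, h2⟩
    refine ⟨fun i hi j hij => ?_, fun v => ?_⟩
    · have := h1 i j hij
      have := hψ j
      simp only [toCover_some, toCover_none, if_pos hi, if_neg ((hA i j hij).1 hi)] at *
      omega
    · obtain ⟨w, hw, e⟩ := h2 v
      exact ⟨w, hw, (toCover_tight_iff hA hψ hw).1 e⟩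
  · rintro ⟨h1, h2⟩
    refine ⟨?_, fun v => ?_⟩
    · have key : ∀ i j, G.Adj i j → i ∈ A →
          toCover A k ψ none ≤ toCover A k ψ (some i) + toCover A k ψ (some j) := by
        intro i j hij hi
        have := h1 i hi j hij
        simp only [toCover_some, toCover_none, if_pos hi, if_neg ((hA i j hij).1 hi)]
        omega
      intro i j hij
      by_cases hi : i ∈ A
      · exact key i j hij hi
      · rw [add_comm]
        exact key j i hij.symm (by_contra fun h => hi ((hA i j hij).2 h))
    · obtain ⟨w, hw, e⟩ := h2 v
      exact ⟨w, hw, (toCover_tight_iff hA hψ hw).2 e⟩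

theorem exists_toCover_eq {A : Finset V} (hA : ∀ v w, G.Adj v w → (v ∈ A ↔ w ∉ A))
    (hdeg : ∀ v, ∃ w, G.Adj v w) {c : Option V →₀ ℕ} (hc : IsBasic G c) :
    ∃ ψ : V → ℕ, (∀ v, ψ v ≤ c none) ∧ IsLayering G A ψ ∧ toCover A (c none) ψ = c := by
  have hle := hc.apply_le hdeg
  have e := toCover_toCover A c hle
  have hψ : ∀ v, toCover A (c none) (fun w => c (some w)) (some v) ≤ c none := by
    intro v
    have := hle v
    rw [toCover_some]
    split_ifs <;> omega
  exact ⟨_, hψ, (isBasic_toCover_iff hA hdeg hψ).1 (e.symm ▸ hc), e⟩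

/-- The basic `k`-covers are in bijection with the layerings with values in `{0, …, k}`. -/
theorem bijective_toCover {A : Finset V} (hA : ∀ v w, G.Adj v w → (v ∈ A ↔ w ∉ A))
    (hdeg : ∀ v, ∃ w, G.Adj v w) (k : ℕ) :
    Function.Bijective fun ψ : {ψ : V → Fin (k + 1) // IsLayering G A ψ} =>
      (⟨toCover A k fun v => ψ.1 v, (isBasic_toCover_iff hA hdeg fun v => by omega).2
        (ψ.2.comp_monotone (f := fun x : Fin (k + 1) => (x : ℕ)) fun _ _ h => h), rfl⟩ :
        {c : Option V →₀ ℕ // IsBasic G c ∧ c none = k}) := by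
  constructor
  · intro ψ ψ' e
    refine Subtype.ext (funext fun v => Fin.ext ?_)
    have h1 := DFunLike.congr_fun (congrArg Subtype.val e) (some v)
    simp only [toCover_some] at h1
    have := (ψ.1 v).2
    have := (ψ'.1 v).2
    split_ifs at h1 <;> omega
  · rintro ⟨c, hc, rfl⟩
    obtain ⟨ψ, hψ, hl, e⟩ := exists_toCover_eq hA hdeg hc
    refine ⟨⟨fun v => ⟨ψ v, Nat.lt_succ_of_le (hψ v)⟩, ?_⟩, Subtype.ext e⟩
    exact IsLayering.of_comp_strictMono (f := fun x : Fin (c none + 1) => (x : ℕ))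
      (fun _ _ h => h) hl

theorem finite_basicCovers {A : Finset V} (hA : ∀ v w, G.Adj v w → (v ∈ A ↔ w ∉ A))
    (hdeg : ∀ v, ∃ w, G.Adj v w) (k : ℕ) :
    Finite {c : Option V →₀ ℕ // IsBasic G c ∧ c none = k} :=
  Finite.of_surjective _ (bijective_toCover hA hdeg k).2

theorem card_basicCovers {A : Finset V} (hA : ∀ v w, G.Adj v w → (v ∈ A ↔ w ∉ A))
    (hdeg : ∀ v, ∃ w, G.Adj v w) (k : ℕ) :
    Nat.card {c : Option V →₀ ℕ // IsBasic G c ∧ c none = k} = layerings G A (k + 1) :=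
  (Nat.card_congr (Equiv.ofBijective _ (bijective_toCover hA hdeg k))).symm

end BasicCovers

/-! ### The monomial basis of the basic cover algebra and its Hilbert function. -/

section Algebra

variable {K : Type u} [Field K] {V : Type v} {G : SimpleGraph V}

theorem monomial_mem_vertexCoverAlgebra {c : Option V →₀ ℕ} (hc : IsCover G c) (a : K) :
    MvPolynomial.monomial c a ∈ vertexCoverAlgebra K G := by
  intro c' hc'
  rw [Finset.mem_singleton.1 (MvPolynomial.support_monomial_subset hc')]
  exact hc

variable (K) in
/-- The monomial `x^c t^k` of `A(G)` given by a cover. -/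
def coverMonomial {c : Option V →₀ ℕ} (hc : IsCover G c) : vertexCoverAlgebra K G :=
  ⟨MvPolynomial.monomial c 1, monomial_mem_vertexCoverAlgebra hc 1⟩

theorem coverMonomial_mul {c c' : Option V →₀ ℕ} (hc : IsCover G c) (hc' : IsCover G c') :
    coverMonomial K hc * coverMonomial K hc' = coverMonomial K (hc.add hc') :=
  Subtype.ext (by simp [coverMonomial, MvPolynomial.monomial_mul])

theorem coverMonomial_zero : coverMonomial K (isCover_zero (G := G)) = 1 := rfl

theorem coverMonomial_congr {c c' : Option V →₀ ℕ} (hc : IsCover G c) (e : c = c') :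
    coverMonomial K hc = coverMonomial K (e ▸ hc : IsCover G c') := by
  subst e; rfl

theorem eq_sum_coverMonomial (f : vertexCoverAlgebra K G) :
    f = ∑ c ∈ (f : MvPolynomial (Option V) K).support.attach,
      (f : MvPolynomial (Option V) K).coeff c • coverMonomial K (f.2 c c.2) := by
  refine Subtype.ext ?_
  conv_lhs => rw [(f : MvPolynomial (Option V) K).as_sum, ← Finset.sum_attach]
  rw [AddSubmonoidClass.coe_finsetSum]
  refine Finset.sum_congr rfl fun c _ => ?_
  simp [coverMonomial, MvPolynomial.smul_monomial]

/-- A nonbasic cover monomial is a variable times another cover monomial, and adding a cover to a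
nonbasic cover leaves it nonbasic. Thus the ideal is spanned by the nonbasic monomials. -/
theorem mem_irrelevantExtension_iff (f : vertexCoverAlgebra K G) :
    f ∈ irrelevantExtension K G ↔
      ∀ c ∈ (f : MvPolynomial (Option V) K).support, ¬ IsBasic G c := by
  classical
  constructor
  · let J : Ideal (vertexCoverAlgebra K G) :=
      { carrier := {f | ∀ c ∈ (f : MvPolynomial (Option V) K).support, ¬ IsBasic G c}
        add_mem' := by
          intro f g hf hg c hc
          rcases Finset.mem_union.1 (MvPolynomial.support_add hc) with h | h
          exacts [hf c h, hg c h]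
        zero_mem' := by
          intro c hc
          simp at hc
        smul_mem' := by
          intro g f hf c hc
          obtain ⟨c₁, h₁, c₂, h₂, rfl⟩ := Finset.mem_add.1 (MvPolynomial.support_mul _ _ hc)
          have hnb := hf c₂ h₂
          simp only [IsBasic, not_and, not_forall, not_not] at hnb
          obtain ⟨c', v, hc', e⟩ := hnb (f.2 c₂ h₂)
          intro hb
          exact hb.2 (c₁ + c') v ((g.2 c₁ h₁).add hc') (by rw [e, add_assoc]) }
    have hle : irrelevantExtension K G ≤ J := by
      refine Ideal.span_le.2 ?_
      rintro _ ⟨v, rfl⟩ c hc hb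
      have hc : c ∈ (MvPolynomial.X (some v) : MvPolynomial (Option V) K).support := hc
      rw [MvPolynomial.support_X, Finset.mem_singleton] at hc
      exact hb.2 0 v isCover_zero (by rw [hc, zero_add])
    exact fun hf => hle hf
  · intro hf
    rw [eq_sum_coverMonomial f]
    refine Ideal.sum_mem _ fun c _ => Submodule.smul_of_tower_mem _ _ ?_
    have hnb := hf c c.2
    simp only [IsBasic, not_and, not_forall, not_not] at hnb
    obtain ⟨c', v, hc', e⟩ := hnb (f.2 c c.2)
    have : coverMonomial K (f.2 c c.2) = coverMonomial K hc' *
        ⟨MvPolynomial.X (some v), X_mem_vertexCoverAlgebra K G v⟩ := by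
      refine Subtype.ext ?_
      simp only [coverMonomial, MulMemClass.coe_mul, MvPolynomial.X, MvPolynomial.monomial_mul,
        mul_one, ← e]
    rw [this]
    exact Ideal.mul_mem_left _ _ (Ideal.subset_span ⟨v, rfl⟩)

/-- A surjective homomorphism from `A(G)` which identifies its target with `Ā(G)`: it kills exactly
the polynomials without monomials of basic covers. -/
structure IsBasicProjection {R : Type*} [CommRing R] [Algebra K R]
    (π : vertexCoverAlgebra K G →ₐ[K] R) : Prop where
  surjective : Function.Surjective π
  eq_zero_iff : ∀ f, π f = 0 ↔ ∀ c ∈ (f : MvPolynomial (Option V) K).support, ¬ IsBasic G c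

theorem isBasicProjection_toBasic : IsBasicProjection (toBasic K G) where
  surjective := Ideal.Quotient.mk_surjective
  eq_zero_iff f := by
    rw [← mem_irrelevantExtension_iff]
    exact Ideal.Quotient.eq_zero_iff_mem

variable (K G) in
/-- The elements of `A(G)` all of whose exponents satisfy `P`. -/
def supportedIn (P : (Option V →₀ ℕ) → Prop) : Submodule K (vertexCoverAlgebra K G) where
  carrier := {f | ∀ c ∈ (f : MvPolynomial (Option V) K).support, P c}
  add_mem' := by
    classical
    intro f g hf hg c hc
    rcases Finset.mem_union.1 (MvPolynomial.support_add hc) with h | h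
    exacts [hf c h, hg c h]
  zero_mem' := by
    intro c hc
    simp at hc
  smul_mem' := by
    intro a f hf c hc
    exact hf c (MvPolynomial.support_smul hc)

theorem coverMonomial_mem_supportedIn {P : (Option V →₀ ℕ) → Prop} {c : Option V →₀ ℕ}
    (hc : IsCover G c) (hP : P c) : coverMonomial K hc ∈ supportedIn K G P := by
  intro c' hc'
  rw [Finset.mem_singleton.1 (MvPolynomial.support_monomial_subset hc')]
  exact hP

variable {R : Type*} [CommRing R] [Algebra K R] {π : vertexCoverAlgebra K G →ₐ[K] R}

/-- The images of the monomials of the basic covers which satisfy `P`. -/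
def basicMonomial (π : vertexCoverAlgebra K G →ₐ[K] R) (P : (Option V →₀ ℕ) → Prop)
    (c : {c : Option V →₀ ℕ // IsBasic G c ∧ P c}) : R :=
  π (coverMonomial K c.2.1.1)

namespace IsBasicProjection

theorem map_coverMonomial_eq_zero (h : IsBasicProjection π) {c : Option V →₀ ℕ} (hc : IsCover G c)
    (hb : ¬ IsBasic G c) : π (coverMonomial K hc) = 0 :=
  (h.eq_zero_iff _).2 (coverMonomial_mem_supportedIn (P := fun c => ¬ IsBasic G c) hc hb)

theorem map_supportedIn (h : IsBasicProjection π) (P : (Option V →₀ ℕ) → Prop) :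
    (supportedIn K G P).map π.toLinearMap = Submodule.span K (Set.range (basicMonomial π P)) := by
  refine le_antisymm ?_ ?_
  · rintro _ ⟨f, hf, rfl⟩
    rw [eq_sum_coverMonomial f, map_sum]
    refine Submodule.sum_mem _ fun c _ => ?_
    rw [map_smul]
    refine Submodule.smul_mem _ _ ?_
    by_cases hb : IsBasic G (c : Option V →₀ ℕ)
    · exact Submodule.subset_span ⟨⟨c, hb, hf c c.2⟩, rfl⟩
    · exact (h.map_coverMonomial_eq_zero (f.2 c c.2) hb).symm ▸ Submodule.zero_mem _
  · rw [Submodule.span_le]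
    rintro _ ⟨c, rfl⟩
    exact ⟨coverMonomial K c.2.1.1, coverMonomial_mem_supportedIn _ c.2.2, rfl⟩

theorem linearIndependent_basicMonomial (h : IsBasicProjection π)
    (P : (Option V →₀ ℕ) → Prop) : LinearIndependent K (basicMonomial π P) := by
  classical
  rw [linearIndependent_iff']
  intro s g hg i hi
  by_contra hne
  have h0 : π (∑ j ∈ s, g j • coverMonomial K j.2.1.1) = 0 := by
    rw [map_sum, ← hg]
    exact Finset.sum_congr rfl fun j _ => map_smul _ _ _
  rw [h.eq_zero_iff] at h0
  refine h0 i.1 ?_ i.2.1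
  rw [MvPolynomial.mem_support_iff, AddSubmonoidClass.coe_finsetSum, MvPolynomial.coeff_sum,
    Finset.sum_eq_single i]
  · simpa [coverMonomial] using hne
  · intro j _ hj
    have : (j : Option V →₀ ℕ) ≠ i := fun e => hj (Subtype.ext e)
    simp [coverMonomial, this]
  · exact fun h => absurd hi h

theorem finrank_map_supportedIn (h : IsBasicProjection π) (P : (Option V →₀ ℕ) → Prop)
    [Finite {c : Option V →₀ ℕ // IsBasic G c ∧ P c}] :
    Module.finrank K ((supportedIn K G P).map π.toLinearMap) =
      Nat.card {c : Option V →₀ ℕ // IsBasic G c ∧ P c} := by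
  have := Fintype.ofFinite {c : Option V →₀ ℕ // IsBasic G c ∧ P c}
  rw [h.map_supportedIn, finrank_span_eq_card (h.linearIndependent_basicMonomial P),
    Nat.card_eq_fintype_card]

theorem finiteDimensional_map_supportedIn (h : IsBasicProjection π)
    (P : (Option V →₀ ℕ) → Prop) [Finite {c : Option V →₀ ℕ // IsBasic G c ∧ P c}] :
    FiniteDimensional K ((supportedIn K G P).map π.toLinearMap) := by
  rw [h.map_supportedIn]
  exact FiniteDimensional.span_of_finite K (Set.finite_range _)

variable [Fintype V] [DecidableEq V]

/-- The image of `A(G)` has multiplicity the number of surjective layerings with `r` values, if its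
dimension is `r + 1` and there is a vertex cover with `r` elements. -/
theorem hasMultiplicity (h : IsBasicProjection π) {A W : Finset V}
    (hA : ∀ v w, G.Adj v w → (v ∈ A ↔ w ∉ A)) (hdeg : ∀ v, ∃ w, G.Adj v w)
    (hW : ∀ u v, G.Adj u v → u ∈ W ∨ v ∈ W)
    (hdim : ringKrullDim R = ((W.card + 1 : ℕ) : WithBot ℕ∞)) :
    HasMultiplicity K (fun k => (vertexCoverComponent K G k).map π.toLinearMap)
      (surjectiveLayerings G A W.card : ℝ) := by
  have hfin := finite_basicCovers hA hdeg
  -- The component of degree `k` is definitionally `supportedIn K G fun c => c none = k`.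
  refine ⟨fun k => h.finiteDimensional_map_supportedIn fun c => c none = k, W.card, hdim, ?_⟩
  refine (tendsto_layerings (A := A) hW).congr fun k => ?_
  rw [← card_basicCovers hA hdeg k, ← h.finrank_map_supportedIn fun c => c none = k]
  rfl

end IsBasicProjection

end Algebra

/-! ### The upper bound for the dimension, by growth and Noether normalization. -/

section UpperBound

variable {K : Type u} [Field K] {V : Type v} {G : SimpleGraph V}
  {R : Type*} [CommRing R] [Algebra K R] {π : vertexCoverAlgebra K G →ₐ[K] R}

/-- The elements of degree at most `N`. -/
def degreeLE (π : vertexCoverAlgebra K G →ₐ[K] R) (N : ℕ) : Submodule K R :=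
  (supportedIn K G fun c => c none ≤ N).map π.toLinearMap

theorem one_mem_degreeLE : (1 : R) ∈ degreeLE π 0 :=
  ⟨coverMonomial K isCover_zero, coverMonomial_mem_supportedIn _ le_rfl, by
    rw [coverMonomial_zero]; exact map_one π⟩

theorem degreeLE_mono {N M : ℕ} (h : N ≤ M) : degreeLE π N ≤ degreeLE π M :=
  Submodule.map_mono fun _ hf c hc => (hf c hc).trans h

theorem mul_mem_degreeLE {x y : R} {N M : ℕ} (hx : x ∈ degreeLE π N) (hy : y ∈ degreeLE π M) :
    x * y ∈ degreeLE π (N + M) := by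
  classical
  obtain ⟨f, hf, rfl⟩ := hx
  obtain ⟨g, hg, rfl⟩ := hy
  refine ⟨f * g, ?_, map_mul π f g⟩
  intro c hc
  obtain ⟨c₁, h₁, c₂, h₂, rfl⟩ := Finset.mem_add.1 (MvPolynomial.support_mul _ _ hc)
  exact add_le_add (hf c₁ h₁) (hg c₂ h₂)

theorem pow_mem_degreeLE {x : R} {N : ℕ} (hx : x ∈ degreeLE π N) (n : ℕ) :
    x ^ n ∈ degreeLE π (n * N) := by
  induction n with
  | zero => simpa using one_mem_degreeLE (π := π)
  | succ n ih => rw [pow_succ, add_mul, one_mul]; exact mul_mem_degreeLE ih hx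

theorem prod_mem_degreeLE {ι : Type*} (s : Finset ι) {x : ι → R} {N : ι → ℕ}
    (hx : ∀ i, x i ∈ degreeLE π (N i)) : ∏ i ∈ s, x i ∈ degreeLE π (∑ i ∈ s, N i) := by
  classical
  induction s using Finset.induction_on with
  | empty => simpa using one_mem_degreeLE (π := π)
  | insert i s hi ih =>
    rw [Finset.prod_insert hi, Finset.sum_insert hi]
    exact mul_mem_degreeLE (hx i) ih

theorem exists_mem_degreeLE (hπ : Function.Surjective π) (x : R) : ∃ N, x ∈ degreeLE π N := by
  obtain ⟨f, rfl⟩ := hπ x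
  exact ⟨(f : MvPolynomial (Option V) K).support.sup fun c => c none, f,
    fun c hc => Finset.le_sup (f := fun c : Option V →₀ ℕ => c none) hc, rfl⟩

variable [Fintype V] [DecidableEq V]

theorem finite_basicCovers_le {A : Finset V} (hA : ∀ v w, G.Adj v w → (v ∈ A ↔ w ∉ A))
    (hdeg : ∀ v, ∃ w, G.Adj v w) (N : ℕ) :
    Finite {c : Option V →₀ ℕ // IsBasic G c ∧ c none ≤ N} := by
  have := finite_basicCovers hA hdeg
  refine Finite.of_injective (β := Σ k : Fin (N + 1), {c : Option V →₀ ℕ // IsBasic G c ∧ c none = k})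
    (fun c => ⟨⟨c.1 none, Nat.lt_succ_of_le c.2.2⟩, ⟨c.1, c.2.1, rfl⟩⟩) ?_
  rintro ⟨c, hc, h⟩ ⟨c', hc', h'⟩ e
  have := congrArg (fun z => (z.2 : Option V →₀ ℕ)) e
  exact Subtype.ext this

theorem card_basicCovers_le {A : Finset V} (hA : ∀ v w, G.Adj v w → (v ∈ A ↔ w ∉ A))
    (hdeg : ∀ v, ∃ w, G.Adj v w) (N : ℕ) :
    Nat.card {c : Option V →₀ ℕ // IsBasic G c ∧ c none ≤ N} ≤
      ∑ k ∈ Finset.range (N + 1), layerings G A (k + 1) := by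
  have := finite_basicCovers hA hdeg
  have hcard : Nat.card (Σ k : Fin (N + 1), {c : Option V →₀ ℕ // IsBasic G c ∧ c none = k}) =
      ∑ k ∈ Finset.range (N + 1), layerings G A (k + 1) := by
    rw [Nat.card_sigma, ← Fin.sum_univ_eq_sum_range (fun k => layerings G A (k + 1))]
    exact Finset.sum_congr rfl fun k _ => card_basicCovers hA hdeg k
  rw [← hcard]
  refine Nat.card_le_card_of_injective
    (fun c => ⟨⟨c.1 none, Nat.lt_succ_of_le c.2.2⟩, ⟨c.1, c.2.1, rfl⟩⟩) ?_
  rintro ⟨c, hc, h⟩ ⟨c', hc', h'⟩ e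
  have := congrArg (fun z => (z.2 : Option V →₀ ℕ)) e
  exact Subtype.ext this

namespace IsBasicProjection

theorem exists_finrank_degreeLE_le (h : IsBasicProjection π) {A W : Finset V}
    (hA : ∀ v w, G.Adj v w → (v ∈ A ↔ w ∉ A)) (hdeg : ∀ v, ∃ w, G.Adj v w)
    (hW : ∀ u v, G.Adj u v → u ∈ W ∨ v ∈ W) :
    ∃ C, ∀ N, Module.finrank K (degreeLE π N) ≤ C * (N + 1) ^ (W.card + 1) := by
  obtain ⟨C, hC⟩ := exists_layerings_le (A := A) hW
  refine ⟨C, fun N => ?_⟩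
  have := finite_basicCovers_le hA hdeg N
  rw [degreeLE, h.finrank_map_supportedIn fun c => c none ≤ N]
  refine (card_basicCovers_le hA hdeg N).trans ?_
  calc ∑ k ∈ Finset.range (N + 1), layerings G A (k + 1)
      ≤ ∑ k ∈ Finset.range (N + 1), C * (N + 1) ^ W.card := by
        refine Finset.sum_le_sum fun k hk => (hC _ k.succ_pos).trans ?_
        exact Nat.mul_le_mul_left _ (Nat.pow_le_pow_left (Finset.mem_range.1 hk) _)
    _ = C * (N + 1) ^ (W.card + 1) := by
        rw [Finset.sum_const, Finset.card_range, smul_eq_mul, pow_succ]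
        ring

/-- Splitting off the lowest level of a layering leaves a layering on both sides, so this identity
shows that the algebra is generated in degree one. -/
theorem toCover_succ (A : Finset V) (k : ℕ) {ψ : V → ℕ} (hψ : ∀ v, ψ v ≤ k + 1) :
    toCover A (k + 1) ψ = toCover A k (fun v => ψ v - 1) + toCover A 1 (fun v => min (ψ v) 1) := by
  ext o
  cases o with
  | none => rfl
  | some v =>
    have := hψ v
    simp only [Finsupp.add_apply, toCover_some]
    split_ifs <;> omega

theorem finiteType (h : IsBasicProjection π) {A : Finset V}
    (hA : ∀ v w, G.Adj v w → (v ∈ A ↔ w ∉ A)) (hdeg : ∀ v, ∃ w, G.Adj v w) :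
    Algebra.FiniteType K R := by
  have hfin := finite_basicCovers hA hdeg 1
  set S := Algebra.adjoin K (Set.range (basicMonomial π fun c => c none = 1))
  have key : ∀ (k : ℕ) (ψ : V → ℕ), (∀ v, ψ v ≤ k) → IsLayering G A ψ →
      ∀ hc : IsCover G (toCover A k ψ), π (coverMonomial K hc) ∈ S := by
    intro k
    induction k with
    | zero =>
      intro ψ hψ hl hc
      obtain rfl : ψ = 0 := funext fun v => by simpa using hψ v
      rw [coverMonomial_congr hc (toCover_zero A), coverMonomial_zero, map_one]
      exact S.one_mem
    | succ k ih =>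
      intro ψ hψ hl hc
      have h1 : IsLayering G A fun v => ψ v - 1 :=
        hl.comp_monotone (f := fun n => n - 1) fun a b hab => Nat.sub_le_sub_right hab 1
      have h2 : IsLayering G A fun v => min (ψ v) 1 :=
        hl.comp_monotone (f := fun n => min n 1) fun a b hab => min_le_min_right 1 hab
      have hle1 : ∀ v, ψ v - 1 ≤ k := fun v => by have := hψ v; omega
      have hb1 := (isBasic_toCover_iff hA hdeg hle1).2 h1
      have hb2 := (isBasic_toCover_iff hA hdeg (k := 1) fun v => min_le_right (ψ v) 1).2 h2
      rw [coverMonomial_congr hc (toCover_succ A k hψ), ← coverMonomial_mul hb1.1 hb2.1, map_mul]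
      exact S.mul_mem (ih _ hle1 h1 hb1.1) (Algebra.subset_adjoin ⟨⟨_, hb2, rfl⟩, rfl⟩)
  have htop : S = ⊤ := by
    rw [eq_top_iff]
    rintro x -
    obtain ⟨f, rfl⟩ := h.surjective x
    rw [eq_sum_coverMonomial f, map_sum]
    refine S.sum_mem fun c _ => ?_
    rw [map_smul]
    refine S.smul_mem ?_ _
    by_cases hb : IsBasic G (c : Option V →₀ ℕ)
    · obtain ⟨ψ, hψ, hl, e⟩ := exists_toCover_eq hA hdeg hb
      rw [coverMonomial_congr (f.2 c c.2) e.symm]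
      exact key _ ψ hψ hl _
    · rw [h.map_coverMonomial_eq_zero (f.2 c c.2) hb]
      exact S.zero_mem
  refine ⟨⟨(Set.finite_range (basicMonomial π fun c => c none = 1)).toFinset, ?_⟩⟩
  rw [Set.Finite.coe_toFinset]
  exact htop

/-- The number of algebraically independent elements of `Ā(G)` is at most one more than the size
of a vertex cover. -/
theorem le_card_cover_of_injective (h : IsBasicProjection π) {A W : Finset V}
    (hA : ∀ v w, G.Adj v w → (v ∈ A ↔ w ∉ A)) (hdeg : ∀ v, ∃ w, G.Adj v w)
    (hW : ∀ u v, G.Adj u v → u ∈ W ∨ v ∈ W) {s : ℕ} (g : MvPolynomial (Fin s) K →ₐ[K] R)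
    (hg : Function.Injective g) : s ≤ W.card + 1 := by
  obtain ⟨C, hC⟩ := h.exists_finrank_degreeLE_le hA hdeg hW
  choose N hN using fun i => exists_mem_degreeLE h.surjective (g (MvPolynomial.X i))
  -- The monomials in the `s` independent elements with all exponents at most `m` are linearly
  -- independent and lie in degree at most `m * ∑ i, N i`.
  have key : ∀ m, (m + 1) ^ s ≤ C * (∑ i, N i + 1) ^ (W.card + 1) * (m + 1) ^ (W.card + 1) := by
    intro m
    set D := m * ∑ i, N i
    have := finite_basicCovers_le hA hdeg D
    have := h.finiteDimensional_map_supportedIn fun c => c none ≤ D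
    have : FiniteDimensional K (degreeLE π D) := this
    let e : (Fin s → Fin (m + 1)) → (Fin s →₀ ℕ) := fun z =>
      Finsupp.equivFunOnFinite.symm fun i => (z i : ℕ)
    have he : Function.Injective e := by
      intro z z' hz
      funext i
      exact Fin.ext (DFunLike.congr_fun hz i)
    have hmem : ∀ z, g (MvPolynomial.monomial (e z) 1) ∈ degreeLE π D := by
      intro z
      rw [MvPolynomial.monomial_eq, map_one, one_mul, Finsupp.prod_fintype _ _ (by simp), map_prod]
      refine degreeLE_mono ?_ (prod_mem_degreeLE Finset.univ (N := fun i => (z i : ℕ) * N i)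
        fun i => ?_)
      · simp only [D, Finset.mul_sum]
        exact Finset.sum_le_sum fun i _ =>
          Nat.mul_le_mul_right _ (Nat.lt_succ_iff.1 (z i).2)
      · rw [map_pow]
        exact pow_mem_degreeLE (hN i) _
    have hli : LinearIndependent K fun z => g (MvPolynomial.monomial (e z) 1) := by
      have h1 := (MvPolynomial.basisMonomials (Fin s) K).linearIndependent.comp e he
      have h2 := h1.map' g.toLinearMap (LinearMap.ker_eq_bot.2 hg)
      rwa [MvPolynomial.coe_basisMonomials] at h2
    have hli' : LinearIndependent K fun z => (⟨_, hmem z⟩ : degreeLE π D) :=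
      LinearIndependent.of_comp (degreeLE π D).subtype hli
    have hcard := hli'.fintype_card_le_finrank
    rw [Fintype.card_fun, Fintype.card_fin, Fintype.card_fin] at hcard
    refine hcard.trans ((hC D).trans ?_)
    rw [mul_assoc, ← mul_pow]
    refine Nat.mul_le_mul_left _ (Nat.pow_le_pow_left ?_ _)
    simp only [D]
    nlinarith [Nat.zero_le (∑ i, N i), Nat.zero_le m]
  by_contra! hlt
  set C' := C * (∑ i, N i + 1) ^ (W.card + 1)
  -- Taking `m = C'` already makes the larger exponent impossible.
  have h1 : (C' + 1) ^ (W.card + 2) ≤ C' * (C' + 1) ^ (W.card + 1) :=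
    (Nat.pow_le_pow_right (Nat.succ_pos _) hlt).trans (key C')
  rw [pow_succ, mul_comm] at h1
  have := Nat.le_of_mul_le_mul_right h1 (by positivity)
  omega

theorem ringKrullDim_le [Nontrivial R] (h : IsBasicProjection π) {A W : Finset V}
    (hA : ∀ v w, G.Adj v w → (v ∈ A ↔ w ∉ A)) (hdeg : ∀ v, ∃ w, G.Adj v w)
    (hW : ∀ u v, G.Adj u v → u ∈ W ∨ v ∈ W) :
    ringKrullDim R ≤ ((W.card + 1 : ℕ) : WithBot ℕ∞) := by
  have := h.finiteType hA hdeg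
  obtain ⟨s, g, hg, hint⟩ := exists_integral_inj_algHom_of_fg K R
  have hs := h.le_card_cover_of_injective hA hdeg hW g hg
  -- Incomparability of primes in an integral extension bounds the dimension by that of the
  -- polynomial ring.
  have hmono : StrictMono (PrimeSpectrum.comap g.toRingHom) := by
    intro p q hpq
    let _ := g.toRingHom.toAlgebra
    have : Algebra.IsIntegral (MvPolynomial (Fin s) K) R := ⟨hint⟩
    exact Ideal.IsIntegral.comap_lt_comap hpq
  calc ringKrullDim R ≤ ringKrullDim (MvPolynomial (Fin s) K) :=
        Order.krullDim_le_of_strictMono _ hmono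
    _ = (s : WithBot ℕ∞) := by
        rw [MvPolynomial.ringKrullDim_of_isNoetherianRing, ringKrullDim_eq_zero_of_field]
        simp
    _ ≤ _ := by exact_mod_cast hs

end IsBasicProjection

end UpperBound

/-! ### The lower bound for the dimension, by a chain of primes from a layering. -/

section LowerBound

variable {K : Type u} [Field K] {V : Type v} {G : SimpleGraph V}

/-- The exponents of the covers which are tight on a set `T` of edges. -/
def IsTightOn (T : V → V → Prop) (c : Option V →₀ ℕ) : Prop :=
  ∀ u v, T u v → c (some u) + c (some v) = c none

/-- The slack on an edge is nonnegative and additive, so the tight covers form a face of the monoid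
of covers. This is what makes projection to the tight monomials multiplicative. -/
theorem isTightOn_add_iff {T : V → V → Prop} (hT : ∀ u v, T u v → G.Adj u v)
    {c c' : Option V →₀ ℕ} (hc : IsCover G c) (hc' : IsCover G c') :
    IsTightOn T (c + c') ↔ IsTightOn T c ∧ IsTightOn T c' := by
  constructor
  · intro h
    constructor <;>
    · intro u v huv
      have h1 := h u v huv
      have := hc u v (hT u v huv)
      have := hc' u v (hT u v huv)
      simp only [Finsupp.add_apply] at h1
      omega
  · rintro ⟨h, h'⟩ u v huv
    have := h u v huv
    have := h' u v huv
    simp only [Finsupp.add_apply]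
    omega

open Classical in
variable (K) in
/-- The projection of polynomials onto the span of the monomials which are tight on `T`. -/
def tightPartLinear (T : V → V → Prop) :
    MvPolynomial (Option V) K →ₗ[K] MvPolynomial (Option V) K :=
  (MvPolynomial.basisMonomials (Option V) K).constr K fun c =>
    if IsTightOn T c then MvPolynomial.monomial c 1 else 0

open Classical in
theorem tightPartLinear_monomial (T : V → V → Prop) (c : Option V →₀ ℕ) :
    tightPartLinear K T (MvPolynomial.monomial c 1) =
      if IsTightOn T c then MvPolynomial.monomial c 1 else 0 := by
  have h := (MvPolynomial.basisMonomials (Option V) K).constr_basis K (fun c =>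
    if IsTightOn T c then MvPolynomial.monomial c (1 : K) else 0) c
  rwa [MvPolynomial.coe_basisMonomials] at h

theorem tightPartLinear_mul {T : V → V → Prop} (hT : ∀ u v, T u v → G.Adj u v)
    (f g : vertexCoverAlgebra K G) :
    tightPartLinear K T ((f * g : vertexCoverAlgebra K G) : MvPolynomial (Option V) K) =
      tightPartLinear K T f * tightPartLinear K T g := by
  classical
  have hf : (f : MvPolynomial (Option V) K) = ∑ c ∈ (f : MvPolynomial (Option V) K).support,
      (f : MvPolynomial (Option V) K).coeff c • MvPolynomial.monomial c (1 : K) := by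
    conv_lhs => rw [(f : MvPolynomial (Option V) K).as_sum]
    simp [MvPolynomial.smul_monomial]
  have hg : (g : MvPolynomial (Option V) K) = ∑ c ∈ (g : MvPolynomial (Option V) K).support,
      (g : MvPolynomial (Option V) K).coeff c • MvPolynomial.monomial c (1 : K) := by
    conv_lhs => rw [(g : MvPolynomial (Option V) K).as_sum]
    simp [MvPolynomial.smul_monomial]
  rw [MulMemClass.coe_mul]
  have key : ∀ c ∈ (f : MvPolynomial (Option V) K).support,
      ∀ c' ∈ (g : MvPolynomial (Option V) K).support,
      tightPartLinear K T (MvPolynomial.monomial c 1 * MvPolynomial.monomial c' 1) =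
        tightPartLinear K T (MvPolynomial.monomial c 1) *
          tightPartLinear K T (MvPolynomial.monomial c' 1) := by
    intro c hc c' hc'
    rw [MvPolynomial.monomial_mul, mul_one, tightPartLinear_monomial, tightPartLinear_monomial,
      tightPartLinear_monomial, isTightOn_add_iff hT (f.2 c hc) (g.2 c' hc')]
    by_cases h1 : IsTightOn T c <;> by_cases h2 : IsTightOn T c' <;>
      simp [h1, h2, MvPolynomial.monomial_mul]
  conv_lhs => rw [hf, hg]
  conv_rhs => rw [hf, hg]
  simp only [map_sum, map_smul, Finset.sum_mul_sum, smul_mul_smul_comm]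
  exact Finset.sum_congr rfl fun c hc => Finset.sum_congr rfl fun c' hc' => by
    rw [key c hc c' hc']

variable (K) in
/-- The homomorphism on `A(G)` which kills the monomials of the covers which are not tight on the
set `T` of edges. -/
def tightPart {T : V → V → Prop} (hT : ∀ u v, T u v → G.Adj u v) :
    vertexCoverAlgebra K G →+* MvPolynomial (Option V) K where
  toFun f := tightPartLinear K T f
  map_one' := by
    classical
    have h := tightPartLinear_monomial (K := K) T 0
    rwa [if_pos (show IsTightOn T 0 from fun _ _ _ => by simp)] at h
  map_mul' := tightPartLinear_mul hT
  map_zero' := map_zero (tightPartLinear K T)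
  map_add' f g := map_add (tightPartLinear K T) (f : MvPolynomial (Option V) K) g

theorem tightPart_coverMonomial {T : V → V → Prop} (hT : ∀ u v, T u v → G.Adj u v)
    {c : Option V →₀ ℕ} (hc : IsCover G c) (h : IsTightOn T c) :
    tightPart K hT (coverMonomial K hc) = MvPolynomial.monomial c 1 := by
  classical
  exact (tightPartLinear_monomial T c).trans (if_pos h)

/-- If every vertex lies on an edge of `T`, covers tight on `T` are basic, so no nonbasic monomial
survives. -/
theorem tightPart_eq_zero {T : V → V → Prop} (hT : ∀ u v, T u v → G.Adj u v)
    (hdeg : ∀ v, ∃ w, G.Adj v w) (hT' : ∀ v, ∃ w, T v w) {f : vertexCoverAlgebra K G}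
    (hf : ∀ c ∈ (f : MvPolynomial (Option V) K).support, ¬ IsBasic G c) :
    tightPart K hT f = 0 := by
  classical
  rw [eq_sum_coverMonomial f, map_sum]
  refine Finset.sum_eq_zero fun c _ => ?_
  have h0 : tightPart K hT (coverMonomial K (f.2 c c.2)) = 0 := by
    refine (tightPartLinear_monomial T c.1).trans (if_neg fun h => hf c c.2 ?_)
    rw [isBasic_iff hdeg]
    refine ⟨f.2 c c.2, fun v => ?_⟩
    obtain ⟨w, hw⟩ := hT' v
    exact ⟨w, hT v w hw, h v w hw⟩
  refine (map_smul (tightPartLinear K T) _ _).trans ?_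
  exact (congrArg _ h0).trans (smul_zero _)

open Classical in
variable (K) in
/-- The substitution of `1` for the variables outside `S`. -/
def keepVars (S : Set (Option V)) : MvPolynomial (Option V) K →ₐ[K] MvPolynomial (Option V) K :=
  MvPolynomial.aeval fun o => if o ∈ S then MvPolynomial.X o else 1

theorem keepVars_keepVars {S S' : Set (Option V)} (h : S ⊆ S') (f : MvPolynomial (Option V) K) :
    keepVars K S (keepVars K S' f) = keepVars K S f := by
  classical
  have : (keepVars K S).comp (keepVars K S') = keepVars K S := by
    refine MvPolynomial.algHom_ext fun o => ?_
    by_cases h1 : o ∈ S'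
    · simp [keepVars, h1]
    · have h2 : o ∉ S := fun h2 => h1 (h h2)
      simp [keepVars, h1, h2]
  exact DFunLike.congr_fun this f

open Classical in
theorem keepVars_monomial (S : Set (Option V)) (c : Option V →₀ ℕ) :
    keepVars K S (MvPolynomial.monomial c 1) = MvPolynomial.monomial (c.filter (· ∈ S)) 1 := by
  rw [keepVars, MvPolynomial.aeval_monomial, map_one, one_mul, MvPolynomial.monomial_eq, map_one,
    one_mul, Finsupp.prod_filter_index, Finsupp.prod, Finsupp.support_filter,
    Finset.prod_filter]
  refine Finset.prod_congr rfl fun o _ => ?_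
  split_ifs <;> simp

variable {R : Type*} [CommRing R] [Algebra K R] {π : vertexCoverAlgebra K G →ₐ[K] R}

namespace IsBasicProjection

/-- A homomorphism from `A(G)` to a domain which kills all nonbasic covers induces a prime ideal
of `Ā(G)`. -/
theorem exists_prime (h : IsBasicProjection π) {D : Type*} [CommRing D] [IsDomain D]
    (φ : vertexCoverAlgebra K G →+* D)
    (hφ : ∀ f : vertexCoverAlgebra K G,
      (∀ c ∈ (f : MvPolynomial (Option V) K).support, ¬ IsBasic G c) → φ f = 0) :
    ∃ p : PrimeSpectrum R, ∀ f, π f ∈ p.asIdeal ↔ φ f = 0 := by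
  have hker : RingHom.ker π.toRingHom ≤ RingHom.ker φ := fun f hf =>
    hφ f ((h.eq_zero_iff f).1 hf)
  let q : R →+* D := π.toRingHom.liftOfSurjective h.surjective ⟨φ, hker⟩
  have hq : ∀ f, q (π f) = φ f := fun f =>
    RingHom.liftOfSurjective_comp_apply π.toRingHom h.surjective ⟨φ, hker⟩ f
  refine ⟨⟨RingHom.ker q, RingHom.ker_isPrime q⟩, fun f => ?_⟩
  rw [← hq f]
  rfl

variable [Fintype V] [DecidableEq V]

theorem le_ringKrullDim (h : IsBasicProjection π) {A : Finset V}
    (hA : ∀ v w, G.Adj v w → (v ∈ A ↔ w ∉ A)) (hdeg : ∀ v, ∃ w, G.Adj v w)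
    {ψ : V → ℕ} (hψ : IsLayering G A ψ) {r : ℕ} (hr : ∀ t < r, ∃ w, ψ w = t) :
    ((r + 1 : ℕ) : WithBot ℕ∞) ≤ ringKrullDim R := by
  classical
  let T : V → V → Prop := fun u v => G.Adj u v ∧ ψ v = ψ u
  have hT : ∀ u v, T u v → G.Adj u v := fun _ _ h => h.1
  have hT' : ∀ v, ∃ w, T v w := hψ.tight
  -- The truncations of `ψ + 1` at `l` are layerings constant on `T`, hence give tight covers. The
  -- degree `r + 1` is positive even when `r = 0`, which separates `c 0` from the zero cover.
  let c : ℕ → Option V →₀ ℕ := fun l => toCover A (r + 1) fun v => min (ψ v + 1) l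
  have hmono : ∀ l : ℕ, Monotone fun n : ℕ => min (n + 1) l := fun l a b hab =>
    min_le_min_right l (Nat.succ_le_succ hab)
  have hcle : ∀ l ≤ r, ∀ v, min (ψ v + 1) l ≤ r + 1 := fun l hl v =>
    (min_le_right _ _).trans (by omega)
  have hcov : ∀ l ≤ r, IsCover G (c l) := fun l hl =>
    ((isBasic_toCover_iff hA hdeg (hcle l hl)).2 (hψ.comp_monotone (hmono l))).1
  have hct : ∀ l ≤ r, IsTightOn T (c l) := by
    intro l hl u v huv
    refine (toCover_tight_iff hA (hcle l hl) huv.1).2 ?_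
    simp only [huv.2]
  -- `S 0` is empty, `S 1` contains only `t`, and `S (l + 2)` also contains the variables on levels
  -- at most `l`. The prime `p m` is the kernel after setting the variables outside `S m` to `1`, so
  -- `p m` shrinks as `m` grows.
  let S : ℕ → Set (Option V) := fun m =>
    {o | (o = none ∧ 0 < m) ∨ ∃ w, o = some w ∧ ψ w + 1 < m}
  have hS : ∀ {m n}, m ≤ n → S m ⊆ S n := by
    rintro m n hmn o (⟨rfl, h⟩ | ⟨w, rfl, h⟩)
    exacts [Or.inl ⟨rfl, by omega⟩, Or.inr ⟨w, rfl, by omega⟩]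
  choose p hp using fun m => h.exists_prime ((keepVars K (S m)).toRingHom.comp (tightPart K hT))
    fun f hf => by
      rw [RingHom.comp_apply, tightPart_eq_zero hT hdeg hT' hf, map_zero]
  have hp' : ∀ m f, π f ∈ (p m).asIdeal ↔ keepVars K (S m) (tightPart K hT f) = 0 := hp
  have hle : ∀ m, p (m + 1) ≤ p m := by
    intro m x hx
    obtain ⟨f, rfl⟩ := h.surjective x
    rw [hp'] at hx ⊢
    rw [← keepVars_keepVars (hS m.le_succ), hx, map_zero]
  have hdiff : ∀ m (c₁ c₂ : Option V →₀ ℕ), IsCover G c₁ → IsCover G c₂ → IsTightOn T c₁ →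
      IsTightOn T c₂ → (∀ o ∈ S m, c₁ o = c₂ o) → (∃ o ∈ S (m + 1), c₁ o ≠ c₂ o) →
      p (m + 1) < p m := by
    intro m c₁ c₂ hc₁ hc₂ ht₁ ht₂ heq hne
    refine lt_of_le_not_ge (hle m) fun hge => ?_
    have h1 : π (coverMonomial K hc₁ - coverMonomial K hc₂) ∈ (p m).asIdeal := by
      rw [hp', map_sub, map_sub, tightPart_coverMonomial hT hc₁ ht₁,
        tightPart_coverMonomial hT hc₂ ht₂, keepVars_monomial, keepVars_monomial, sub_eq_zero]
      refine congrArg (fun d => MvPolynomial.monomial d (1 : K)) (Finsupp.ext fun o => ?_)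
      by_cases ho : o ∈ S m
      · simp only [Finsupp.filter_apply, if_pos ho, heq o ho]
      · simp only [Finsupp.filter_apply, if_neg ho]
    have h2 := hge h1
    rw [hp', map_sub, map_sub, tightPart_coverMonomial hT hc₁ ht₁,
      tightPart_coverMonomial hT hc₂ ht₂, keepVars_monomial, keepVars_monomial, sub_eq_zero] at h2
    have h3 := MvPolynomial.monomial_left_injective one_ne_zero h2
    obtain ⟨o, ho, hno⟩ := hne
    have h4 := DFunLike.congr_fun h3 o
    simp only [Finsupp.filter_apply, if_pos ho] at h4
    exact hno h4
  have hlt : ∀ m < r + 1, p (m + 1) < p m := by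
    intro m hm
    cases m with
    | zero =>
      refine hdiff 0 0 (c 0) isCover_zero (hcov 0 (Nat.zero_le r)) (fun _ _ _ => by simp)
        (hct 0 (Nat.zero_le r)) ?_ ⟨none, Or.inl ⟨rfl, Nat.one_pos⟩, ?_⟩
      · rintro o (⟨-, h⟩ | ⟨w, -, h⟩) <;> omega
      · simp [c]
    | succ l =>
      obtain ⟨w, hw⟩ := hr l (by omega)
      -- The covers `c l` and `c (l + 1)` agree on levels below `l` and differ at a vertex of level
      -- `l`, the level that enters with `S (l + 2)`.
      refine hdiff (l + 1) (c l) (c (l + 1)) (hcov l (by omega)) (hcov (l + 1) (by omega))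
        (hct l (by omega)) (hct (l + 1) (by omega)) ?_ ⟨some w, Or.inr ⟨w, rfl, by omega⟩, ?_⟩
      · rintro o (⟨rfl, h⟩ | ⟨w', rfl, h⟩)
        · rfl
        · simp only [c, toCover_some]
          rw [min_eq_left (by omega), min_eq_left (by omega)]
      · simp only [c, toCover_some, hw]
        split_ifs <;> omega
  let s : LTSeries (PrimeSpectrum R) := LTSeries.mk (r + 1) (fun i => p (r + 1 - i)) (by
    rw [Fin.strictMono_iff_lt_succ]
    intro i
    have h1 : r + 1 - (i.castSucc : ℕ) = r + 1 - (i.succ : ℕ) + 1 := by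
      simp only [Fin.val_castSucc, Fin.val_succ]
      omega
    rw [h1]
    exact hlt _ (by simp only [Fin.val_succ]; omega))
  exact Order.LTSeries.length_le_krullDim s

end IsBasicProjection

end LowerBound

end CoverAlgebra

end

theorem theorem6 {K : Type*} [Field K] {V : Type*} [Fintype V] [DecidableEq V] [Nontrivial V]
    (G : SimpleGraph V) (hG : G.IsTree)
    (A B : Finset V) (hunion : A ∪ B = Finset.univ)
    (hbip : G.IsBipartiteWith (A : Set V) (B : Set V)) (hcard : A.card ≤ B.card)
    (a r : ℕ) (ha : a = A.card) (hr : r = CoverAlgebra.gdim G - 1) :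
    ringKrullDim (CoverAlgebra.basicCoverAlgebra K G) = (CoverAlgebra.gdim G : WithBot ℕ∞) ∧
    ∃ e : ℕ,
      CoverAlgebra.HasMultiplicity K (CoverAlgebra.basicCoverComponent K G) (e : ℝ) ∧
      (r < a → e ≤ (a - r) ^ r * a.descFactorial r) ∧
      e ≤ r ^ (a - r) * a.descFactorial r := by
  have hdisj : Disjoint A B := Finset.disjoint_coe.1 hbip.disjoint
  have hA : ∀ v w, G.Adj v w → (v ∈ A ↔ w ∉ A) := by
    intro v w h
    have h1 : v ∈ A → v ∉ B := fun h => Finset.disjoint_left.1 hdisj h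
    have h2 : w ∈ A → w ∉ B := fun h => Finset.disjoint_left.1 hdisj h
    rcases hbip.mem_of_adj h with ⟨h3, h4⟩ | ⟨h3, h4⟩
    · exact ⟨fun _ h5 => h2 h5 h4, fun _ => h3⟩
    · exact ⟨fun h5 => absurd h3 (h1 h5), fun h5 => absurd h4 h5⟩
  have hdeg : ∀ v, ∃ w, G.Adj v w := fun v => by
    rw [← SimpleGraph.mem_support, hG.connected.preconnected.support_eq_univ]
    exact Set.mem_univ v
  obtain ⟨W, x, y, hW⟩ := CoverAlgebra.exists_isOrderedMatchingCover hG hA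
  have hgdim := hW.gdim_eq hunion hbip hcard
  obtain rfl : r = W.card := by omega
  subst ha
  obtain ⟨ψ, hψ, hvals⟩ := hW.exists_isLayering hA hdeg
  have hπ := CoverAlgebra.isBasicProjection_toBasic (K := K) (G := G)
  have hlow := hπ.le_ringKrullDim hA hdeg hψ hvals
  -- The zero ring has dimension `⊥`, which the lower bound excludes.
  have hnt : Nontrivial (CoverAlgebra.basicCoverAlgebra K G) := by
    by_contra h
    rw [not_nontrivial_iff_subsingleton] at h
    rw [ringKrullDim_eq_bot_of_subsingleton] at hlow
    exact absurd hlow (by simp)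
  have hdim := le_antisymm (hπ.ringKrullDim_le hA hdeg hW.cover) hlow
  refine ⟨?_, CoverAlgebra.surjectiveLayerings G A W.card,
    hπ.hasMultiplicity hA hdeg hW.cover hdim,
    CoverAlgebra.surjectiveLayerings_le_of_lt hG hA hW.cover,
    CoverAlgebra.surjectiveLayerings_le hA W.card⟩
  rw [hdim, hgdim, add_comm]
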